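/- Let $(\Omega,\mathcal F,\mathbb P)$ be a complete probability space, let $\mathcal G\subseteq\mathcal F$ be a $\sigma$-algebra containing all $\mathbb P$-null sets, let $d\ge 1$ be an integer, and let $Y:\Omega\to\mathbb R^d$ be $\mathcal F$-measurable. Let $D(\omega)$ be the affine hull of the support of the regular conditional distribution of $Y$ given $\mathcal G$ at $\omega$. Let $\Xi^d$ be the set of $\mathcal G$-measurable $\xi:\Omega\to\mathbb R^d$, and let $\widetilde\Xi^d$ be the set of those $\xi\in\Xi^d$ with $\xi(\omega)\in D(\omega)$ for a.e. $\omega$. For a $\mathcal G$-measurable $H:\Omega\to\mathbb R$ with $H\ge 0$ a.s. (in particular for a constant $x\ge 0$), put $\Xi^d(H)=\{\xi\in\Xi^d: H+\langle\xi,Y\rangle\ge 0\text{ a.s.}\}$ and $\widetilde\Xi^d(H)=\Xi^d(H)\cap\widetilde\Xi^d$. For a real random variable $X$, $\mathbb E[X|\mathcal G]$ denotes the generalized conditional expectation $\mathbb E[X^+|\mathcal G]-\mathbb E[X^-|\mathcal G]$. Let $V:[0,\infty)\times\Omega\to\mathbb R$. Assume: (a) for a.e. $\omega$, $D(\omega)$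 is a linear subspace of $\mathbb R^d$; (b) there are $\mathcal G$-measurable real random variables $\beta,\kappa>0$ a.s. such that, for every $\xi\in\widetilde\Xi^d$, $\mathbb P(\langle\xi,Y\rangle\le-\beta\|\xi\|\,|\,\mathcal G)\ge\kappa$ a.s.; (c) $V(x,\cdot)$ is $\mathcal F$-measurable for each $x\ge 0$, and for a.e. $\omega$ the function $V(\cdot,\omega)$ is continuous and non-decreasing on $[0,\infty)$; (d) for every $x\ge 0$, $\operatorname{ess\,sup}_{\xi\in\Xi^d(x)}\mathbb E[V^+(x+\langle\xi,Y\rangle,\cdot)|\mathcal G]<+\infty$ a.s.; (e) $\mathbb E[V^-(0,\cdot)|\mathcal G]<+\infty$ a.s.; (f) there are a constant $\gamma>0$ and a random variable $\bar C\ge 0$ a.s. with $\mathbb E[\bar C]<+\infty$ such that, for a.e. $\omega$, $V^+(\lambda x,\omega)\le\lambda^\gamma V^+(x,\omega)+\lambda^\gamma\bar C(\omega)$ simultaneously for all $\lambda\ge 1$ and $x\ge 0$. Then there is a function $G:[0,\infty)\times\Omega\to\mathbb R$, measurable with respect to $\mathcal B([0,\infty))\otimes\mathcal G$, such that: (i)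 for each $x\ge 0$, $G(x,\cdot)$ is a version of $\operatorname{ess\,sup}_{\xi\in\Xi^d(x)}\mathbb E[V(x+\langle\xi,Y\rangle,\cdot)|\mathcal G]$; (ii) for a.e. $\omega$, $G(\cdot,\omega)$ is non-decreasing and continuous on $[0,\infty)$; (iii) for every $\mathcal G$-measurable $H:\Omega\to\mathbb R$ with $H\ge 0$ a.s., $G(H(\cdot),\cdot)=\operatorname{ess\,sup}_{\xi\in\Xi^d(H)}\mathbb E[V(H+\langle\xi,Y\rangle,\cdot)|\mathcal G]$ a.s.; (iv) for every such $H$ there is $\widetilde\xi(H)\in\widetilde\Xi^d(H)$ with $G(H(\cdot),\cdot)=\mathbb E[V(H+\langle\widetilde\xi(H),Y\rangle,\cdot)|\mathcal G]$ a.s. -/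

import Mathlib

open MeasureTheory ProbabilityTheory
open scoped ENNReal

noncomputable section

namespace OneStep

/-- The regular conditional distribution of `Y` given the sub-σ-algebra `𝒢`: a Markov kernel from
`(Ω, 𝒢)` to `ℝ^d`, obtained as the conditional law of `Y` given the identity map
`(Ω, mΩ) → (Ω, 𝒢)`. -/
def condLaw {Ω : Type*} {d : ℕ} (𝒢 : MeasurableSpace Ω) [mΩ : MeasurableSpace Ω]
    (P : Measure Ω) [IsProbabilityMeasure P] (Y : Ω → EuclideanSpace ℝ (Fin d)) :
    @Kernel Ω (EuclideanSpace ℝ (Fin d)) 𝒢 _ :=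
  @condDistrib Ω Ω (EuclideanSpace ℝ (Fin d)) _ _ _ mΩ 𝒢 Y id P _

/-- `D(ω)`: the affine hull of the support of the conditional law of `Y` given `𝒢` at `ω`. -/
def condAffineHull {Ω : Type*} {d : ℕ} (𝒢 : MeasurableSpace Ω) [mΩ : MeasurableSpace Ω]
    (P : Measure Ω) [IsProbabilityMeasure P] (Y : Ω → EuclideanSpace ℝ (Fin d)) (ω : Ω) :
    AffineSubspace ℝ (EuclideanSpace ℝ (Fin d)) :=
  affineSpan ℝ (condLaw 𝒢 P Y ω).support

/-- `Ξ^d(H)`: the `𝒢`-measurable `ξ : Ω → ℝ^d` with `H + ⟨ξ, Y⟩ ≥ 0` almost surely. -/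
def admissible {Ω : Type*} {d : ℕ} (𝒢 : MeasurableSpace Ω) [mΩ : MeasurableSpace Ω]
    (P : Measure Ω) (Y : Ω → EuclideanSpace ℝ (Fin d)) (H : Ω → ℝ) :
    Set (Ω → EuclideanSpace ℝ (Fin d)) :=
  {ξ | Measurable[𝒢] ξ ∧ ∀ᵐ ω ∂P, 0 ≤ H ω + inner ℝ (ξ ω) (Y ω)}

/-- `Ξ̃^d`: the `𝒢`-measurable `ξ : Ω → ℝ^d` with `ξ(ω) ∈ D(ω)` almost surely. -/
def hullValued {Ω : Type*} {d : ℕ} (𝒢 : MeasurableSpace Ω) [mΩ : MeasurableSpace Ω]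
    (P : Measure Ω) [IsProbabilityMeasure P] (Y : Ω → EuclideanSpace ℝ (Fin d)) :
    Set (Ω → EuclideanSpace ℝ (Fin d)) :=
  {ξ | Measurable[𝒢] ξ ∧ ∀ᵐ ω ∂P, ξ ω ∈ condAffineHull 𝒢 P Y ω}

/-- The generalized conditional expectation `E[X | 𝒢] = E[X⁺ | 𝒢] - E[X⁻ | 𝒢]` of a real random
variable which need not be integrable, as an extended real. It is the usual object at each point
where the two terms are not both infinite. -/
def extCondExp {Ω : Type*} (𝒢 : MeasurableSpace Ω) [mΩ : MeasurableSpace Ω]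
    (P : Measure Ω) (X : Ω → ℝ) (ω : Ω) : EReal :=
  (condLExp 𝒢 P (fun ω' => ENNReal.ofReal (X ω')) ω : EReal)
    - (condLExp 𝒢 P (fun ω' => ENNReal.ofReal (-X ω')) ω : EReal)

/-- `g` is (a version of) the `P`-essential supremum of the family `Φ` of functions on `Ω`: it is
measurable, it dominates each member almost surely, and it is almost surely below each
measurable function with this property. -/
def IsEssSup {Ω α : Type*} [mΩ : MeasurableSpace Ω] [Preorder α] [MeasurableSpace α]
    (P : Measure Ω) (Φ : Set (Ω → α)) (g : Ω → α) : Prop :=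
  Measurable g ∧ (∀ f ∈ Φ, ∀ᵐ ω ∂P, f ω ≤ g ω) ∧
    ∀ h : Ω → α, Measurable h → (∀ f ∈ Φ, ∀ᵐ ω ∂P, f ω ≤ h ω) → ∀ᵐ ω ∂P, g ω ≤ h ω

/-- The family `{E[V(H + ⟨ξ, Y⟩, ·) | 𝒢] : ξ ∈ Ξ^d(H)}`. -/
def valueFamily {Ω : Type*} {d : ℕ} (𝒢 : MeasurableSpace Ω) [mΩ : MeasurableSpace Ω]
    (P : Measure Ω) (Y : Ω → EuclideanSpace ℝ (Fin d)) (V : ℝ → Ω → ℝ) (H : Ω → ℝ) :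
    Set (Ω → EReal) :=
  (fun ξ => extCondExp 𝒢 P (fun ω => V (H ω + inner ℝ (ξ ω) (Y ω)) ω)) '' admissible 𝒢 P Y H

/-- The family `{E[V⁺(H + ⟨ξ, Y⟩, ·) | 𝒢] : ξ ∈ Ξ^d(H)}`. -/
def posValueFamily {Ω : Type*} {d : ℕ} (𝒢 : MeasurableSpace Ω) [mΩ : MeasurableSpace Ω]
    (P : Measure Ω) (Y : Ω → EuclideanSpace ℝ (Fin d)) (V : ℝ → Ω → ℝ) (H : Ω → ℝ) :
    Set (Ω → ℝ≥0∞) :=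
  (fun ξ => condLExp 𝒢 P (fun ω => ENNReal.ofReal (V (H ω + inner ℝ (ξ ω) (Y ω)) ω))) ''
    admissible 𝒢 P Y H

end OneStep

end

/-! Since `V` is non-decreasing in wealth, subtracting `V 0` leaves a nonnegative utility `U`. Every
conditional expected utility is then the conditional expectation of `U` (the gain) plus a finite
`𝒢`-measurable term `e`. It suffices to maximize the gain, where monotone convergence and Fatou hold
in `ℝ≥0∞`.

Compactness: strategies can be projected onto `D` without changing their payoff
(`exists_hullValued`), and absence of arbitrage bounds the projected ones by `H / β`
(`norm_mul_le_of_noArbitrage`). A measurable Bolzano-Weierstrass theorem yields limit strategies.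
The gain does not drop in the limit, by reverse Fatou: in finite dimension all wealths of a bounded
sequence are controlled by finitely many of them, so the growth condition supplies a conditionally
integrable bound (`condLExp_iSup_lt_top`, `exists_limit_strategy`). Gains are stable under pasting
on `𝒢`-events, so a maximizing sequence can be made increasing, and its limit point is optimal for
every random wealth `H` (`exists_maximizer`).

Regularity (`exists_value`): optimal gains at rational wealths, regularized from the right, give a
jointly measurable `g`. Approximating `H` from above by grid values shows that `g` at `H` is the
optimal gain at `H`. No concavity is available for left continuity. Instead, a left jump of a path
across a rational level occurs at a `𝒢`-measurable random wealth `T`; scaling a strategy optimal for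
`T` by factors increasing to 1, together with Fatou, rules the jump out. -/

namespace OneStep

open Filter Topology

/-! ### Locality and limit theorems for nonnegative conditional expectations. -/

section CondLExp

variable {Ω : Type*} {𝒢 mΩ : MeasurableSpace Ω} {P : Measure Ω} [IsProbabilityMeasure P]

theorem condLExp_indicator (h𝒢 : 𝒢 ≤ mΩ) (X : Ω → ℝ≥0∞) {s : Set Ω} (hs : MeasurableSet[𝒢] s) :
    s.indicator (condLExp 𝒢 P X) =ᵐ[P] condLExp 𝒢 P (s.indicator X) := by
  refine ae_eq_condLExp h𝒢 P _ ((measurable_condLExp 𝒢 P X).indicator hs) fun t ht => ?_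
  rw [setLIntegral_indicator (h𝒢 s hs), setLIntegral_indicator (h𝒢 s hs),
    setLIntegral_condLExp h𝒢 P X (hs.inter ht)]

theorem condLExp_le_on (h𝒢 : 𝒢 ≤ mΩ) {X Y : Ω → ℝ≥0∞} {s : Set Ω} (hs : MeasurableSet[𝒢] s)
    (h : ∀ᵐ ω ∂P, ω ∈ s → X ω ≤ Y ω) :
    ∀ᵐ ω ∂P, ω ∈ s → condLExp 𝒢 P X ω ≤ condLExp 𝒢 P Y ω := by
  have h1 : s.indicator X ≤ᵐ[P] s.indicator Y := by
    filter_upwards [h] with ω hω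
    by_cases hs' : ω ∈ s
    · simpa [hs'] using hω hs'
    · simp [hs']
  filter_upwards [condLExp_mono (mΩ := 𝒢) h1, condLExp_indicator (P := P) h𝒢 X hs,
    condLExp_indicator (P := P) h𝒢 Y hs] with ω h2 h3 h4 hω
  rw [← h3, ← h4] at h2
  simpa [hω] using h2

theorem condLExp_eq_on (h𝒢 : 𝒢 ≤ mΩ) {X Y : Ω → ℝ≥0∞} {s : Set Ω} (hs : MeasurableSet[𝒢] s)
    (h : ∀ᵐ ω ∂P, ω ∈ s → X ω = Y ω) :
    ∀ᵐ ω ∂P, ω ∈ s → condLExp 𝒢 P X ω = condLExp 𝒢 P Y ω := by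
  filter_upwards [condLExp_le_on h𝒢 hs (h.mono fun ω hω hs => (hω hs).le),
    condLExp_le_on h𝒢 hs (h.mono fun ω hω hs => (hω hs).ge)] with ω h1 h2 hω
  exact le_antisymm (h1 hω) (h2 hω)

/-- Conditional expectation at a `𝒢`-measurable random index. -/
theorem condLExp_random_index (h𝒢 : 𝒢 ≤ mΩ) (X : ℕ → Ω → ℝ≥0∞) {N : Ω → ℕ}
    (hN : Measurable[𝒢] N) :
    ∀ᵐ ω ∂P, condLExp 𝒢 P (fun ω' => X (N ω') ω') ω = condLExp 𝒢 P (X (N ω)) ω := by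
  have : ∀ n, ∀ᵐ ω ∂P, ω ∈ N ⁻¹' {n} →
      condLExp 𝒢 P (fun ω' => X (N ω') ω') ω = condLExp 𝒢 P (X n) ω := fun n =>
    condLExp_eq_on h𝒢 (hN (measurableSet_singleton n)) <| Eventually.of_forall fun ω hω => by
      rw [Set.mem_preimage, Set.mem_singleton_iff] at hω; rw [hω]
  filter_upwards [ae_all_iff.2 this] with ω hω
  exact hω _ rfl

theorem condLExp_lt_top_of_cover (h𝒢 : 𝒢 ≤ mΩ) {X : Ω → ℝ≥0∞} (N : Ω → ℕ)
    (hN : Measurable[𝒢] N) (Z : ℕ → Ω → ℝ≥0∞)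
    (hZ : ∀ n, ∀ᵐ ω ∂P, condLExp 𝒢 P (Z n) ω < ∞) (hXZ : ∀ᵐ ω ∂P, X ω ≤ Z (N ω) ω) :
    ∀ᵐ ω ∂P, condLExp 𝒢 P X ω < ∞ := by
  filter_upwards [ae_all_iff.2 hZ, condLExp_mono (mΩ := 𝒢) hXZ,
    condLExp_random_index h𝒢 Z hN] with ω h1 h2 h3
  exact (h2.trans_eq h3).trans_lt (h1 _)

theorem condLExp_iSup (h𝒢 : 𝒢 ≤ mΩ) {X : ℕ → Ω → ℝ≥0∞} (hX : ∀ n, Measurable (X n))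
    (hmono : Monotone X) :
    (fun ω => ⨆ n, condLExp 𝒢 P (X n) ω) =ᵐ[P] condLExp 𝒢 P (fun ω => ⨆ n, X n ω) := by
  refine ae_eq_condLExp h𝒢 P _
    (Measurable.iSup fun n => measurable_condLExp 𝒢 P (X n)) fun s hs => ?_
  rw [lintegral_iSup hX hmono, lintegral_iSup_ae]
  · simp_rw [setLIntegral_condLExp h𝒢 P _ hs]
  · exact fun n => measurable_condLExp' 𝒢 P (X n)
  · exact fun n => ae_restrict_of_ae
      (condLExp_mono (Eventually.of_forall (hmono n.le_succ)))

/-- Conditional Fatou lemma. -/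
theorem condLExp_liminf_le (h𝒢 : 𝒢 ≤ mΩ) {X : ℕ → Ω → ℝ≥0∞} (hX : ∀ n, Measurable (X n)) :
    ∀ᵐ ω ∂P, condLExp 𝒢 P (fun ω' => liminf (fun n => X n ω') atTop) ω ≤
      liminf (fun n => condLExp 𝒢 P (X n) ω) atTop := by
  simp_rw [liminf_eq_iSup_iInf_of_nat]
  have hmono : Monotone fun n (ω : Ω) => ⨅ i ≥ n, X i ω := fun a b hab ω =>
    le_iInf₂ fun i hi => iInf₂_le i (hab.trans hi)
  have key : ∀ n i, n ≤ i → ∀ᵐ ω ∂P,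
      condLExp 𝒢 P (fun ω => ⨅ i ≥ n, X i ω) ω ≤ condLExp 𝒢 P (X i) ω := fun n i hi =>
    condLExp_mono (Eventually.of_forall fun ω => iInf₂_le i hi)
  have key' : ∀ᵐ ω ∂P, ∀ n i, n ≤ i →
      condLExp 𝒢 P (fun ω => ⨅ i ≥ n, X i ω) ω ≤ condLExp 𝒢 P (X i) ω := by
    simp_rw [ae_all_iff]
    exact key
  filter_upwards [key', condLExp_iSup (P := P) h𝒢
    (fun n => Measurable.iInf fun i => Measurable.iInf fun _ => hX i) hmono] with ω h1 h2
  rw [← h2]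
  exact iSup_mono fun n => le_iInf₂ fun i hi => h1 n i hi

/-- On each `𝒢`-event where the conditional expectation is at most `n`, `W` has finite integral;
these events exhaust the space up to a null set. -/
theorem ae_lt_top_of_condLExp (h𝒢 : 𝒢 ≤ mΩ) {W : Ω → ℝ≥0∞} (hW : Measurable W)
    (h : ∀ᵐ ω ∂P, condLExp 𝒢 P W ω < ∞) : ∀ᵐ ω ∂P, W ω < ∞ := by
  have hm : ∀ n : ℕ, MeasurableSet[𝒢] {ω | condLExp 𝒢 P W ω ≤ n} := fun n =>
    measurableSet_le (measurable_condLExp 𝒢 P W) measurable_const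
  have : ∀ n : ℕ, ∀ᵐ ω ∂P, ω ∈ {ω | condLExp 𝒢 P W ω ≤ n} → W ω < ∞ := fun n => by
    rw [← ae_restrict_iff' (h𝒢 _ (hm n))]
    refine ae_lt_top hW ?_
    rw [← setLIntegral_condLExp h𝒢 P W (hm n)]
    refine ((setLIntegral_mono measurable_const fun ω hω => hω).trans_lt
      (b := ∫⁻ _ in {ω | condLExp 𝒢 P W ω ≤ n}, (n : ℝ≥0∞) ∂P) ?_).ne
    rw [setLIntegral_const]
    exact ENNReal.mul_lt_top (by simp) (measure_lt_top _ _)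
  filter_upwards [h, ae_all_iff.2 this] with ω h1 h2
  obtain ⟨n, hn⟩ := ENNReal.exists_nat_gt h1.ne
  exact h2 n hn.le

/-- Conditional reverse Fatou lemma under a conditionally integrable bound. -/
theorem liminf_condLExp_le_of_tendsto (h𝒢 : 𝒢 ≤ mΩ) {X : ℕ → Ω → ℝ≥0∞} {Z W : Ω → ℝ≥0∞}
    (hX : ∀ n, Measurable (X n)) (hZ : Measurable Z) (hW : Measurable W)
    (hWfin : ∀ᵐ ω ∂P, condLExp 𝒢 P W ω < ∞) (hXW : ∀ n, ∀ᵐ ω ∂P, X n ω ≤ W ω)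
    (hlim : ∀ᵐ ω ∂P, Tendsto (fun n => X n ω) atTop (𝓝 (Z ω))) :
    ∀ᵐ ω ∂P, liminf (fun n => condLExp 𝒢 P (X n) ω) atTop ≤ condLExp 𝒢 P Z ω := by
  have hWt := ae_lt_top_of_condLExp h𝒢 hW hWfin
  have hXW' := ae_all_iff.2 hXW
  have hsum : ∀ n, ∀ᵐ ω ∂P, condLExp 𝒢 P (X n) ω + condLExp 𝒢 P (W - X n) ω
      = condLExp 𝒢 P W ω := fun n => by
    have h1 : X n + (W - X n) =ᵐ[P] W := by
      filter_upwards [hXW n] with ω h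
      simp [add_tsub_cancel_of_le h]
    filter_upwards [condLExp_congr_ae (mΩ := 𝒢) h1,
      condLExp_add_left (mΩ := 𝒢) (P := P) (W - X n) (hX n).aemeasurable] with ω h2 h3
    rw [← h2, h3]; rfl
  have hsumZ : ∀ᵐ ω ∂P, condLExp 𝒢 P Z ω + condLExp 𝒢 P (W - Z) ω = condLExp 𝒢 P W ω := by
    have h1 : Z + (W - Z) =ᵐ[P] W := by
      filter_upwards [hXW', hlim] with ω h h'
      simp [add_tsub_cancel_of_le (le_of_tendsto' h' h)]
    filter_upwards [condLExp_congr_ae (mΩ := 𝒢) h1,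
      condLExp_add_left (mΩ := 𝒢) (P := P) (W - Z) hZ.aemeasurable] with ω h2 h3
    rw [← h2, h3]; rfl
  -- Reverse Fatou is Fatou for `W - X n`. Truncated subtraction is continuous here because `W` is
  -- almost surely finite.
  have hZlim : (W - Z) =ᵐ[P] fun ω' => liminf (fun n => (W - X n) ω') atTop := by
    filter_upwards [hWt, hlim] with ω h h'
    exact (ENNReal.Tendsto.sub tendsto_const_nhds h' (Or.inl h.ne)).liminf_eq.symm
  filter_upwards [hWfin, ae_all_iff.2 hsum, hsumZ, condLExp_congr_ae (mΩ := 𝒢) hZlim,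
    condLExp_liminf_le (P := P) h𝒢 (X := fun n => W - X n) (fun n => hW.sub (hX n))]
    with ω h1 h2 h3 h4 h5
  rw [← h4] at h5
  refine le_of_forall_lt fun c hc => ?_
  obtain ⟨c', hcc', hc'⟩ := exists_between hc
  refine hcc'.trans_le ?_
  -- A level `c'` eventually exceeded by the conditional expectations of `X n` costs those of `W - X
  -- n` at least `c'`. This avoids subtracting a limit in `ℝ≥0∞`.
  have hev := eventually_lt_of_lt_liminf hc'
  have hc't : c' ≠ ∞ := hc'.ne_top
  have hb : liminf (fun n => condLExp 𝒢 P (W - X n) ω) atTop ≤ condLExp 𝒢 P W ω - c' := by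
    refine liminf_le_of_frequently_le' (hev.mono fun n hn => ?_).frequently
    exact ENNReal.le_sub_of_add_le_left hc't ((add_le_add_left hn.le _).trans_eq (h2 n))
  have hcW : c' ≤ condLExp 𝒢 P W ω := by
    obtain ⟨n, hn⟩ := hev.exists
    exact hn.le.trans (le_self_add.trans_eq (h2 n))
  have h6 := h5.trans hb
  have h7 : condLExp 𝒢 P (W - Z) ω + c' ≤ condLExp 𝒢 P W ω := by
    calc _ ≤ condLExp 𝒢 P W ω - c' + c' := by gcongr
      _ = _ := tsub_add_cancel_of_le hcW
  rw [← h3, add_comm (condLExp 𝒢 P Z ω)] at h7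
  refine (ENNReal.add_le_add_iff_left ?_).1 h7
  exact ((le_add_self.trans_eq h3).trans_lt h1).ne

end CondLExp

/-! ### Measurable extraction of convergent subsequences. -/

section RandomSubsequence

variable {Ω : Type*} {m : MeasurableSpace Ω}

theorem measurable_comp_index {E : Type*} [MeasurableSpace E] {u : ℕ → Ω → E} {φ : Ω → ℕ}
    (hu : ∀ n, Measurable (u n)) (hφ : Measurable φ) : Measurable fun ω => u (φ ω) ω :=
  (measurable_from_prod_countable_right (f := fun p : ℕ × Ω => u p.1 p.2) hu).comp
    (hφ.prodMk measurable_id)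

/-- The indices are successive hitting times: each is the least one beyond its predecessor that
satisfies the next condition, hence measurable. -/
theorem exists_random_strictMono (p : ℕ → ℕ → Ω → Prop)
    (hp : ∀ k n, MeasurableSet {ω | p k n ω}) (hfreq : ∀ k ω, ∃ᶠ n in atTop, p k n ω) :
    ∃ ψ : ℕ → Ω → ℕ, (∀ k, Measurable (ψ k)) ∧ (∀ ω, StrictMono fun k => ψ k ω) ∧
      ∀ k ω, p k (ψ k ω) ω := by
  classical
  have hex : ∀ (k j : ℕ) (ω : Ω), ∃ n, j < n ∧ p k n ω := fun k j ω => by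
    obtain ⟨n, hn, hpn⟩ := (frequently_atTop.1 (hfreq k ω)) (j + 1)
    exact ⟨n, hn, hpn⟩
  let next : ℕ → ℕ → Ω → ℕ := fun k j ω => Nat.find (hex k j ω)
  have hnext : ∀ k j ω, j < next k j ω ∧ p k (next k j ω) ω := fun k j ω =>
    Nat.find_spec (hex k j ω)
  have hmeas : ∀ k (f : Ω → ℕ), Measurable f → Measurable fun ω => next k (f ω) ω :=
    fun k f hf => measurable_find (p := fun ω n => f ω < n ∧ p k n ω) (fun ω => hex k (f ω) ω)
      fun n => (measurableSet_lt hf measurable_const).inter (hp k n)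
  let ψ : ℕ → Ω → ℕ := fun k => Nat.rec (fun ω => next 0 0 ω)
    (fun k f ω => next (k + 1) (f ω) ω) k
  have hψ : ∀ k ω, ψ (k + 1) ω = next (k + 1) (ψ k ω) ω := fun _ _ => rfl
  refine ⟨ψ, fun k => ?_, fun ω => strictMono_nat_of_lt_succ fun k => ?_, fun k ω => ?_⟩
  · induction k with
    | zero => exact hmeas 0 (fun _ => 0) measurable_const
    | succ k ih => exact hmeas (k + 1) _ ih
  · rw [hψ]
    exact (hnext (k + 1) (ψ k ω) ω).1
  · cases k with
    | zero => exact (hnext 0 0 ω).2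
    | succ k => exact (hnext (k + 1) (ψ k ω) ω).2

/-- The limsup is a measurable choice of cluster point, so it can be aimed at with precision `1 / (k
+ 1)`. -/
theorem exists_random_subseq_real {v : ℕ → Ω → ℝ} (hv : ∀ n, Measurable (v n))
    (hb : ∀ ω, ∃ C, ∀ n, |v n ω| ≤ C) :
    ∃ ψ : ℕ → Ω → ℕ, (∀ k, Measurable (ψ k)) ∧ (∀ ω, StrictMono fun k => ψ k ω) ∧
      ∀ ω, ∃ c, Tendsto (fun k => v (ψ k ω) ω) atTop (𝓝 c) := by
  let c : Ω → ℝ := fun ω => limsup (fun n => v n ω) atTop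
  have hc : Measurable c := Measurable.limsup hv
  have hfreq : ∀ (k : ℕ) ω, ∃ᶠ n in atTop, |v n ω - c ω| < 1 / ((k : ℝ) + 1) := fun k ω => by
    obtain ⟨C, hC⟩ := hb ω
    have hk : 0 < 1 / ((k : ℝ) + 1) := by positivity
    have hbu : IsBoundedUnder (· ≤ ·) atTop fun n => v n ω :=
      isBoundedUnder_of ⟨C, fun n => (abs_le.1 (hC n)).2⟩
    have hbl : IsBoundedUnder (· ≥ ·) atTop fun n => v n ω :=
      isBoundedUnder_of ⟨-C, fun n => (abs_le.1 (hC n)).1⟩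
    have h1 : ∃ᶠ n in atTop, c ω - 1 / ((k : ℝ) + 1) < v n ω :=
      frequently_lt_of_lt_limsup hbl.isCoboundedUnder_le (by change _ < c ω; linarith)
    have h2 : ∀ᶠ n in atTop, v n ω < c ω + 1 / ((k : ℝ) + 1) :=
      eventually_lt_of_limsup_lt (by change c ω < _; linarith) hbu
    exact (h1.and_eventually h2).mono fun n hn => abs_lt.2 ⟨by linarith [hn.1], by linarith [hn.2]⟩
  obtain ⟨ψ, h1, h2, h3⟩ := exists_random_strictMono
    (fun k n ω => |v n ω - c ω| < 1 / ((k : ℝ) + 1))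
    (fun k n => measurableSet_lt ((hv n).sub hc).norm measurable_const) hfreq
  refine ⟨ψ, h1, h2, fun ω => ⟨c ω, ?_⟩⟩
  rw [tendsto_iff_norm_sub_tendsto_zero]
  exact squeeze_zero (fun _ => norm_nonneg _) (fun k => (h3 k ω).le)
    tendsto_one_div_add_atTop_nhds_zero_nat

/-- Coordinates are treated one at a time; refining the subsequence preserves the convergence
already obtained. Here `j` counts the coordinates done. -/
theorem exists_random_subseq_of_bounded {d : ℕ} {u : ℕ → Ω → EuclideanSpace ℝ (Fin d)}
    (hu : ∀ n, Measurable (u n)) (hb : ∀ ω, ∃ C, ∀ n, ‖u n ω‖ ≤ C) (j : ℕ) :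
    ∃ ψ : ℕ → Ω → ℕ, (∀ k, Measurable (ψ k)) ∧ (∀ ω, StrictMono fun k => ψ k ω) ∧
      ∀ ω, ∀ i : Fin d, i.val < j → ∃ c, Tendsto (fun k => u (ψ k ω) ω i) atTop (𝓝 c) := by
  induction j with
  | zero =>
    exact ⟨fun k _ => k, fun _ => measurable_const, fun _ => strictMono_id, by simp⟩
  | succ j ih =>
    obtain ⟨φ, h1, h2, h3⟩ := ih
    by_cases hj : j < d
    · have hcoord : ∀ n, Measurable fun ω => u n ω ⟨j, hj⟩ := fun n => by
        have := hu n
        fun_prop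
      obtain ⟨ψ, g1, g2, g3⟩ := exists_random_subseq_real
        (v := fun k ω => u (φ k ω) ω ⟨j, hj⟩)
        (fun k => measurable_comp_index hcoord (h1 k))
        (fun ω => (hb ω).imp fun C hC n => (PiLp.norm_apply_le _ _).trans (hC _))
      refine ⟨fun k ω => φ (ψ k ω) ω, fun k => measurable_comp_index h1 (g1 k),
        fun ω => (h2 ω).comp (g2 ω), fun ω i hi => ?_⟩
      rcases Nat.lt_succ_iff_lt_or_eq.1 hi with hi | hi
      · obtain ⟨c, hc⟩ := h3 ω i hi
        exact ⟨c, hc.comp (g2 ω).tendsto_atTop⟩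
      · obtain rfl : i = ⟨j, hj⟩ := Fin.ext hi
        exact g3 ω
    · exact ⟨φ, h1, h2, fun ω i _ => h3 ω i (by omega)⟩

/-- A measurable version of the Bolzano-Weierstrass theorem. -/
theorem exists_random_subseq {d : ℕ} {u : ℕ → Ω → EuclideanSpace ℝ (Fin d)}
    (hu : ∀ n, Measurable (u n)) :
    ∃ (ψ : ℕ → Ω → ℕ) (ξ : Ω → EuclideanSpace ℝ (Fin d)), (∀ k, Measurable (ψ k)) ∧
      (∀ ω, StrictMono fun k => ψ k ω) ∧ Measurable ξ ∧
      ∀ ω, (∃ C, ∀ n, ‖u n ω‖ ≤ C) → Tendsto (fun k => u (ψ k ω) ω) atTop (𝓝 (ξ ω)) := by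
  classical
  let B : Set Ω := {ω | ⨆ n, ‖u n ω‖ₑ < ∞}
  have hB : MeasurableSet B :=
    measurableSet_lt (Measurable.iSup fun n => (hu n).enorm) measurable_const
  have hBiff : ∀ ω, ω ∈ B ↔ ∃ C, ∀ n, ‖u n ω‖ ≤ C := fun ω => by
    refine ⟨fun h => ⟨(⨆ n, ‖u n ω‖ₑ).toReal, fun n => ?_⟩, fun ⟨C, hC⟩ => ?_⟩
    · rw [← toReal_enorm]
      exact ENNReal.toReal_mono (ne_of_lt h) (le_iSup (fun n => ‖u n ω‖ₑ) n)
    · refine (iSup_le fun n => ?_).trans_lt (ENNReal.ofReal_lt_top (r := C))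
      rw [← ofReal_norm]
      exact ENNReal.ofReal_le_ofReal (hC n)
  let u' : ℕ → Ω → EuclideanSpace ℝ (Fin d) := fun n => B.indicator (u n)
  have hu' : ∀ n, Measurable (u' n) := fun n => (hu n).indicator hB
  have hb' : ∀ ω, ∃ C, ∀ n, ‖u' n ω‖ ≤ C := fun ω => by
    by_cases hω : ω ∈ B
    · simpa [u', hω] using (hBiff ω).1 hω
    · exact ⟨0, by simp [u', hω]⟩
  obtain ⟨ψ, h1, h2, h3⟩ := exists_random_subseq_of_bounded hu' hb' d
  choose c hc using fun ω (i : Fin d) => h3 ω i i.2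
  have hlim : ∀ ω, Tendsto (fun k => u' (ψ k ω) ω) atTop (𝓝 (WithLp.toLp 2 (c ω))) := fun ω => by
    have h4 : Tendsto (fun k i => u' (ψ k ω) ω i) atTop (𝓝 (c ω)) := tendsto_pi_nhds.2 (hc ω)
    exact ((PiLp.continuous_toLp 2 fun _ : Fin d => ℝ).tendsto (c ω)).comp h4
  refine ⟨ψ, fun ω => WithLp.toLp 2 (c ω), h1, h2,
    measurable_of_tendsto_metrizable (fun k => measurable_comp_index hu' (h1 k))
      (tendsto_pi_nhds.2 hlim), fun ω hω => ?_⟩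
  have hω' := (hBiff ω).2 hω
  simpa [u', hω'] using hlim ω

end RandomSubsequence

/-! ### Measurable projection of strategies onto `D` by the mean ergodic theorem. -/

noncomputable section Projection

variable {d : ℕ}

/-- The contraction `v ↦ v - ⟨y, v⟩ y / (1 + ‖y‖²)`. -/
def damping (y : EuclideanSpace ℝ (Fin d)) :
    EuclideanSpace ℝ (Fin d) →L[ℝ] EuclideanSpace ℝ (Fin d) :=
  ContinuousLinearMap.id ℝ _ - (1 + ‖y‖ ^ 2)⁻¹ • (innerSL ℝ y).smulRight y

theorem damping_apply (y v : EuclideanSpace ℝ (Fin d)) :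
    damping y v = v - (1 + ‖y‖ ^ 2)⁻¹ • (inner ℝ y v : ℝ) • y := by
  simp [damping]

theorem norm_damping_le (y : EuclideanSpace ℝ (Fin d)) : ‖damping y‖ ≤ 1 := by
  refine ContinuousLinearMap.opNorm_le_bound _ zero_le_one fun v => ?_
  rw [one_mul, damping_apply]
  refine le_of_sq_le_sq ?_ (norm_nonneg _)
  rw [norm_sub_sq_real, smul_smul, norm_smul, inner_smul_right, real_inner_comm, mul_pow,
    Real.norm_eq_abs, sq_abs]
  set c := (1 + ‖y‖ ^ 2)⁻¹
  have hc0 : 0 < c := by positivity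
  have hc : c * ‖y‖ ^ 2 ≤ 1 := by
    rw [inv_mul_le_iff₀ (by positivity)]; linarith
  set t : ℝ := inner ℝ y v
  have h1 : c * t ^ 2 * (c * ‖y‖ ^ 2) ≤ c * t ^ 2 * 1 := by gcongr
  have h2 : 0 ≤ c * t ^ 2 := by positivity
  nlinarith

theorem continuous_damping : Continuous (damping (d := d)) := by
  unfold damping
  have h : Continuous fun y : EuclideanSpace ℝ (Fin d) => (1 + ‖y‖ ^ 2)⁻¹ :=
    (continuous_const.add (continuous_norm.pow 2)).inv₀ fun y =>
      (by positivity : (0 : ℝ) < 1 + ‖y‖ ^ 2).ne'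
  have h2 : Continuous fun y : EuclideanSpace ℝ (Fin d) => (innerSL ℝ y).smulRight y :=
    ((ContinuousLinearMap.smulRightL ℝ (EuclideanSpace ℝ (Fin d))
      (EuclideanSpace ℝ (Fin d))).continuous.comp (innerSL ℝ).continuous).clm_apply continuous_id
  exact continuous_const.sub (h.smul h2)

variable (μ : Measure (EuclideanSpace ℝ (Fin d))) [IsProbabilityMeasure μ]

theorem integrable_damping : Integrable (damping (d := d)) μ :=
  Integrable.of_bound continuous_damping.stronglyMeasurable.aestronglyMeasurable 1
    (Eventually.of_forall norm_damping_le)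

/-- The mean of the contractions `damping y` under the law `μ` of `y`. -/
def meanDamping (μ : Measure (EuclideanSpace ℝ (Fin d))) :
    EuclideanSpace ℝ (Fin d) →L[ℝ] EuclideanSpace ℝ (Fin d) := ∫ y, damping y ∂μ

theorem norm_meanDamping_le : ‖meanDamping μ‖ ≤ 1 := by
  simpa [meanDamping] using norm_integral_le_of_norm_le_const (μ := μ)
    (Eventually.of_forall norm_damping_le)

/-- The inner product of `v` with `v - damping y v` equals `⟨v, y⟩² / (1 + ‖y‖²)`, so a fixed vector
has zero mean for this nonnegative quantity. The damping makes everything bounded, so `μ` needs no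
moments. -/
theorem meanDamping_apply_eq_self_iff (v : EuclideanSpace ℝ (Fin d)) :
    meanDamping μ v = v ↔ ∀ᵐ y ∂μ, (inner ℝ v y : ℝ) = 0 := by
  rw [meanDamping, ContinuousLinearMap.integral_apply (integrable_damping μ)]
  have hint : Integrable (fun y => damping y v) μ :=
    (integrable_damping μ).apply_continuousLinearMap v
  constructor
  · intro h
    have h1 : ∫ y, (inner ℝ v (v - damping y v) : ℝ) ∂μ = 0 := by
      have h3 := integral_inner (𝕜 := ℝ) ((integrable_const v).sub hint) v
      simp only [Pi.sub_apply] at h3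
      rw [h3, integral_sub (integrable_const v) hint, h]
      simp
    have h2 : ∀ y : EuclideanSpace ℝ (Fin d), (inner ℝ v (v - damping y v) : ℝ)
        = (1 + ‖y‖ ^ 2)⁻¹ * (inner ℝ v y) ^ 2 := fun y => by
      rw [damping_apply, sub_sub_cancel, inner_smul_right, inner_smul_right, real_inner_comm]
      ring
    rw [integral_eq_zero_iff_of_nonneg] at h1
    · filter_upwards [h1] with y hy
      rw [h2] at hy
      have : (1 + ‖y‖ ^ 2)⁻¹ ≠ 0 := by positivity
      simpa [this] using hy
    · intro y
      simp only [h2, Pi.zero_apply]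
      positivity
    · exact Integrable.const_inner v ((integrable_const v).sub hint)
  · intro h
    have : (fun y => damping y v) =ᵐ[μ] fun _ => v := by
      filter_upwards [h] with y hy
      rw [damping_apply, real_inner_comm, hy]
      simp
    rw [integral_congr_ae this]
    simp

/-- The limit `w` is the orthogonal projection of `v` onto the vectors almost surely orthogonal to
`y`. Expressing it through Birkhoff averages makes its dependence on `μ` and `v` measurable. As `Wᗮ`
lies in the fixed space, `v - w` lies in `W`. -/
theorem exists_birkhoff_limit (v : EuclideanSpace ℝ (Fin d)) :
    ∃ w : EuclideanSpace ℝ (Fin d),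
      Tendsto (birkhoffAverage ℝ (meanDamping μ) _root_.id · v) atTop (𝓝 w) ∧
      (∀ᵐ y ∂μ, (inner ℝ w y : ℝ) = 0) ∧
      ∀ W : Submodule ℝ (EuclideanSpace ℝ (Fin d)), μ.support ⊆ W → v - w ∈ W := by
  let T := meanDamping μ
  let F := T.eqLocus (1 : EuclideanSpace ℝ (Fin d) →L[ℝ] EuclideanSpace ℝ (Fin d))
  refine ⟨F.orthogonalProjectionOnto v,
    ContinuousLinearMap.tendsto_birkhoffAverage_orthogonalProjection T
      (norm_meanDamping_le μ) v, ?_, fun W hW => ?_⟩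
  · exact (meanDamping_apply_eq_self_iff μ _).1 (F.orthogonalProjectionOnto v).2
  · have h1 : Wᗮ ≤ F := fun z hz => by
      refine (meanDamping_apply_eq_self_iff μ z).2 ?_
      filter_upwards [Measure.support_mem_ae (μ := μ)] with y hy
      rw [real_inner_comm]
      exact (Submodule.mem_orthogonal _ _).1 hz y (hW hy)
    have h2 : v - F.orthogonalProjectionOnto v ∈ Fᗮ :=
      F.sub_starProjection_mem_orthogonal v
    rw [← Submodule.orthogonal_orthogonal W]
    exact Submodule.orthogonal_le h1 h2

variable {Ω : Type*} {𝒢 mΩ : MeasurableSpace Ω} {P : Measure Ω} [IsProbabilityMeasure P]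

instance (Y : Ω → EuclideanSpace ℝ (Fin d)) : IsMarkovKernel (condLaw 𝒢 P Y) := by
  unfold condLaw; infer_instance

/-- The joint law of `X` and `Y` disintegrates through the conditional law. -/
theorem ae_of_ae_condDistrib {Ω' : Type*} [MeasurableSpace Ω'] {X : Ω → Ω'} (hX : Measurable X)
    {Y : Ω → EuclideanSpace ℝ (Fin d)} (hY : Measurable Y)
    {p : Ω' → EuclideanSpace ℝ (Fin d) → Prop}
    (hp : MeasurableSet {x : Ω' × EuclideanSpace ℝ (Fin d) | p x.1 x.2})
    (h : ∀ x, ∀ᵐ y ∂(condDistrib Y X P x), p x y) : ∀ᵐ ω ∂P, p (X ω) (Y ω) := by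
  have h2 : ∀ᵐ x ∂(P.map fun a => (X a, Y a)), p x.1 x.2 := by
    rw [← compProd_map_condDistrib hY.aemeasurable, Measure.ae_compProd_iff hp]
    exact Eventually.of_forall h
  exact (ae_map_iff (hX.prodMk hY).aemeasurable hp).1 h2

theorem stronglyMeasurable_meanDamping (Y : Ω → EuclideanSpace ℝ (Fin d)) :
    StronglyMeasurable[𝒢] fun ω => meanDamping (condLaw 𝒢 P Y ω) :=
  StronglyMeasurable.integral_kernel (κ := condLaw 𝒢 P Y) continuous_damping.stronglyMeasurable

/-- Each `𝒢`-measurable strategy can be replaced by one with values in `D` and the same gains. -/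
theorem exists_hullValued (h𝒢 : 𝒢 ≤ mΩ) {Y : Ω → EuclideanSpace ℝ (Fin d)} (hY : Measurable Y)
    (hD : ∀ᵐ ω ∂P, ∃ W : Submodule ℝ (EuclideanSpace ℝ (Fin d)),
      (condAffineHull 𝒢 P Y ω : Set (EuclideanSpace ℝ (Fin d))) = W)
    {ξ : Ω → EuclideanSpace ℝ (Fin d)} (hξ : Measurable[𝒢] ξ) :
    ∃ η ∈ hullValued 𝒢 P Y, ∀ᵐ ω ∂P, (inner ℝ (η ω) (Y ω) : ℝ) = inner ℝ (ξ ω) (Y ω) := by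
  choose ζ hζ1 hζ2 hζ3 using fun ω => exists_birkhoff_limit (condLaw 𝒢 P Y ω) (ξ ω)
  have hT := stronglyMeasurable_meanDamping (𝒢 := 𝒢) (P := P) Y
  have hiter : ∀ n, StronglyMeasurable[𝒢]
      fun ω => (meanDamping (condLaw 𝒢 P Y ω))^[n] (ξ ω) := fun n => by
    induction n with
    | zero => exact hξ.stronglyMeasurable
    | succ n ih =>
      simp_rw [Function.iterate_succ_apply']
      exact (continuous_fst.clm_apply continuous_snd).comp_stronglyMeasurable (hT.prodMk ih)
  have hζ : Measurable[𝒢] ζ := by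
    refine @measurable_of_tendsto_metrizable _ _ 𝒢 _ _ _ _
      (fun n ω => birkhoffAverage ℝ (meanDamping (condLaw 𝒢 P Y ω)) _root_.id n (ξ ω)) ζ
      (fun n => ?_) (tendsto_pi_nhds.2 hζ1)
    simp only [birkhoffAverage, birkhoffSum, id]
    exact ((Finset.stronglyMeasurable_fun_sum (Finset.range n) fun i _ => hiter i).const_smul
      ((n : ℝ)⁻¹)).measurable
  have hζY : ∀ᵐ ω ∂P, (inner ℝ (ζ ω) (Y ω) : ℝ) = 0 := by
    refine @ae_of_ae_condDistrib d Ω mΩ P _ Ω 𝒢 _root_.id (measurable_id'' h𝒢) Y hY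
      (fun ω y => (inner ℝ (ζ ω) y : ℝ) = 0) ?_ hζ2
    have h1 : Measurable[MeasurableSpace.prod 𝒢 inferInstance]
        fun x : Ω × EuclideanSpace ℝ (Fin d) => (inner ℝ (ζ x.1) x.2 : ℝ) :=
      (hζ.comp measurable_fst).inner measurable_snd
    exact h1 (measurableSet_singleton 0)
  refine ⟨fun ω => ξ ω - ζ ω, ⟨hξ.sub hζ, ?_⟩, ?_⟩
  · filter_upwards [hD] with ω ⟨W, hW⟩
    rw [← SetLike.mem_coe, hW]
    refine hζ3 ω W (Set.Subset.trans ?_ hW.le)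
    exact subset_affineSpan _ _
  · filter_upwards [hζY] with ω h
    rw [inner_sub_left, h, sub_zero]

end Projection

/-! ### Finite-dimensional domination and the no-arbitrage bound. -/

/-- The spans of initial segments stabilize, so finitely many `v i` span all the others. A linear,
hence bounded, section of the combination map bounds the coefficients uniformly. One integer `C`
serves as both constant and number of terms. -/
theorem exists_inner_le_sum {E : Type*} [NormedAddCommGroup E] [InnerProductSpace ℝ E]
    [FiniteDimensional ℝ E] (v : ℕ → E) (hv : ∃ B, ∀ n, ‖v n‖ ≤ B) :
    ∃ C : ℕ, ∀ n y,
      |(inner ℝ (v n) y : ℝ)| ≤ C * ∑ i ∈ Finset.range C, |(inner ℝ (v i) y : ℝ)| := by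
  obtain ⟨B, hB⟩ := hv
  have hB0 : 0 ≤ B := (norm_nonneg _).trans (hB 0)
  let F : ℕ →o Submodule ℝ E := ⟨fun m => Submodule.span ℝ (v '' Set.Iio m), fun a b hab =>
    Submodule.span_mono (Set.image_mono (Set.Iio_subset_Iio hab))⟩
  obtain ⟨m, hm⟩ := monotone_stabilizes_iff_noetherian.2 (inferInstance : IsNoetherian ℝ E) F
  let L : (Fin m → ℝ) →ₗ[ℝ] E := Fintype.linearCombination ℝ (fun i : Fin m => v i)
  have hL : LinearMap.range L = F m := by
    rw [Fintype.range_linearCombination]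
    change _ = Submodule.span ℝ _
    congr 1
    ext x
    simp only [Set.mem_range, Set.mem_image, Set.mem_Iio]
    exact ⟨fun ⟨i, hi⟩ => ⟨i, i.2, hi⟩, fun ⟨i, hi, h⟩ => ⟨⟨i, hi⟩, h⟩⟩
  have hmem : ∀ n, v n ∈ LinearMap.range L := fun n => by
    rw [hL]
    have h1 : v n ∈ F (max m (n + 1)) :=
      Submodule.subset_span ⟨n, by simp, rfl⟩
    rwa [← hm _ (le_max_left _ _)] at h1
  obtain ⟨s, hs⟩ := L.rangeRestrict.exists_rightInverse_of_surjective L.range_rangeRestrict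
  let s' := LinearMap.toContinuousLinearMap s
  have hsv : ∀ n, L (s ⟨v n, hmem n⟩) = v n := fun n => by
    have := congrArg Subtype.val (LinearMap.congr_fun hs ⟨v n, hmem n⟩)
    simpa using this
  have hbound : ∀ n i, |s ⟨v n, hmem n⟩ i| ≤ ‖s'‖ * B := fun n i => by
    calc |s ⟨v n, hmem n⟩ i| ≤ ‖s' ⟨v n, hmem n⟩‖ := norm_le_pi_norm (s ⟨v n, hmem n⟩) i
      _ ≤ ‖s'‖ * ‖v n‖ := s'.le_opNorm _
      _ ≤ ‖s'‖ * B := by gcongr; exact hB n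
  let C := max m ⌈‖s'‖ * B⌉₊
  refine ⟨C, fun n y => ?_⟩
  have h1 : (inner ℝ (v n) y : ℝ) = ∑ i : Fin m, s ⟨v n, hmem n⟩ i * inner ℝ (v i) y := by
    conv_lhs => rw [← hsv n]
    simp [L, Fintype.linearCombination_apply, sum_inner, inner_smul_left]
  have hC : ‖s'‖ * B ≤ C := (Nat.le_ceil _).trans (Nat.cast_le.2 (le_max_right _ _))
  calc |(inner ℝ (v n) y : ℝ)| ≤ ∑ i : Fin m, |s ⟨v n, hmem n⟩ i * inner ℝ (v i) y| := by
        rw [h1]; exact Finset.abs_sum_le_sum_abs _ _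
    _ ≤ ∑ i : Fin m, (C : ℝ) * |(inner ℝ (v i) y : ℝ)| := by
        refine Finset.sum_le_sum fun i _ => ?_
        rw [abs_mul]
        exact mul_le_mul_of_nonneg_right ((hbound n i).trans hC) (abs_nonneg _)
    _ = C * ∑ i ∈ Finset.range m, |(inner ℝ (v i) y : ℝ)| := by
        rw [← Finset.mul_sum, Fin.sum_univ_eq_sum_range (fun i => |(inner ℝ (v i) y : ℝ)|)]
    _ ≤ _ := by
        gcongr
        exact le_max_left _ _

theorem exists_measurable_inner_le_sum {Ω : Type*} {m : MeasurableSpace Ω} {d : ℕ}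
    {u : ℕ → Ω → EuclideanSpace ℝ (Fin d)} (hu : ∀ n, Measurable (u n)) :
    ∃ C : Ω → ℕ, Measurable C ∧ ∀ ω, (∃ B, ∀ n, ‖u n ω‖ ≤ B) → ∀ n y,
      |(inner ℝ (u n ω) y : ℝ)| ≤
        C ω * ∑ i ∈ Finset.range (C ω), |(inner ℝ (u i ω) y : ℝ)| := by
  classical
  -- Testing on a dense sequence makes the condition a countable intersection; continuity recovers
  -- every `y`.
  let p : Ω → ℕ → Prop := fun ω C => ∀ n j,
    |(inner ℝ (u n ω) (TopologicalSpace.denseSeq (EuclideanSpace ℝ (Fin d)) j) : ℝ)| ≤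
      C * ∑ i ∈ Finset.range C,
        |(inner ℝ (u i ω) (TopologicalSpace.denseSeq (EuclideanSpace ℝ (Fin d)) j) : ℝ)|
  have hp : ∀ C, MeasurableSet {ω | p ω C} := fun C => by
    have hi : ∀ n y, Measurable fun ω => |(inner ℝ (u n ω) y : ℝ)| := fun n y =>
      continuous_abs.measurable.comp ((hu n).inner measurable_const)
    simp only [p, Set.ofPred_forall]
    exact MeasurableSet.iInter fun n => MeasurableSet.iInter fun j =>
      measurableSet_le (hi _ _)
        (measurable_const.mul (Finset.measurable_fun_sum _ fun i _ => hi _ _))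
  -- The second alternative makes the search total: where no constant works, the answer is 0.
  let q : Ω → ℕ → Prop := fun ω C => p ω C ∨ ∀ C', ¬ p ω C'
  have hq : ∀ C, MeasurableSet {ω | q ω C} := fun C => by
    simp only [q, Set.ofPred_or, Set.ofPred_forall]
    exact (hp C).union (MeasurableSet.iInter fun C' => (hp C').compl)
  have hex : ∀ ω, ∃ C, q ω C := fun ω => by
    by_cases h : ∃ C, p ω C
    · exact h.imp fun C hC => Or.inl hC
    · exact ⟨0, Or.inr (not_exists.1 h)⟩
  refine ⟨fun ω => Nat.find (hex ω), measurable_find hex hq, fun ω hω n y => ?_⟩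
  obtain ⟨C, hC⟩ := exists_inner_le_sum (fun n => u n ω) hω
  have h1 : p ω (Nat.find (hex ω)) :=
    (Nat.find_spec (hex ω)).resolve_right fun h => h C fun n j => hC n _
  have hi : ∀ n, Continuous fun y => |(inner ℝ (u n ω) y : ℝ)| := fun n =>
    (continuous_const.inner continuous_id).abs
  exact (TopologicalSpace.denseRange_denseSeq _).induction_on
    (p := fun y => |(inner ℝ (u n ω) y : ℝ)| ≤ (Nat.find (hex ω) : ℝ) *
      ∑ i ∈ Finset.range (Nat.find (hex ω)), |(inner ℝ (u i ω) y : ℝ)|) y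
    (isClosed_le (hi n) (continuous_const.mul (continuous_finsetSum _ fun i _ => hi i)))
    (h1 n)

/-- Absence of arbitrage bounds the admissible strategies with values in `D`. -/
theorem norm_mul_le_of_noArbitrage {Ω : Type*} {𝒢 mΩ : MeasurableSpace Ω} {P : Measure Ω}
    [IsProbabilityMeasure P] (h𝒢 : 𝒢 ≤ mΩ) {d : ℕ} {Y : Ω → EuclideanSpace ℝ (Fin d)}
    (hY : Measurable Y) {β κ H : Ω → ℝ} {ξ : Ω → EuclideanSpace ℝ (Fin d)}
    (hβ : Measurable[𝒢] β) (hκ : ∀ᵐ ω ∂P, 0 < κ ω) (hH : Measurable[𝒢] H)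
    (hξ : ξ ∈ admissible 𝒢 P Y H)
    (h : ∀ᵐ ω ∂P, κ ω ≤ (P⟦{ω' | inner ℝ (ξ ω') (Y ω') ≤ -β ω' * ‖ξ ω'‖}|𝒢⟧) ω) :
    ∀ᵐ ω ∂P, β ω * ‖ξ ω‖ ≤ H ω := by
  have hξm : Measurable[𝒢] ξ := hξ.1
  set A : Set Ω := {ω' | inner ℝ (ξ ω') (Y ω') ≤ -β ω' * ‖ξ ω'‖} with hA
  have hAm : MeasurableSet[mΩ] A := measurableSet_le ((hξm.mono h𝒢 le_rfl).inner hY)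
    ((hβ.mono h𝒢 le_rfl).neg.mul (hξm.mono h𝒢 le_rfl).norm)
  let B : Set Ω := {ω | H ω < β ω * ‖ξ ω‖}
  have hB : MeasurableSet[𝒢] B := measurableSet_lt hH (hβ.mul (measurable_norm.comp hξm))
  have hint : Integrable (A.indicator fun _ => (1 : ℝ)) P :=
    (integrable_const 1).indicator hAm
  -- On `B` the event `A` would force negative terminal wealth, so `A ∩ B` is null. As the
  -- conditional probability of `A` is at least `κ > 0`, `B` is null too.
  have h0 : ∫ ω in B, (P⟦A|𝒢⟧) ω ∂P = 0 := by
    rw [setIntegral_condExp h𝒢 hint hB]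
    refine setIntegral_eq_zero_of_ae_eq_zero ?_
    filter_upwards [hξ.2] with ω h1 h2
    refine Set.indicator_of_notMem (fun h3 => ?_) _
    have h2' : H ω < β ω * ‖ξ ω‖ := h2
    have h3' : inner ℝ (ξ ω) (Y ω) ≤ -β ω * ‖ξ ω‖ := h3
    linarith
  rw [setIntegral_eq_zero_iff_of_nonneg_ae] at h0
  · rw [Filter.EventuallyEq, ae_restrict_iff' (h𝒢 _ hB)] at h0
    filter_upwards [h0, h, hκ] with ω h1 h2 h3
    by_contra hlt
    have := h1 (not_le.1 hlt)
    rw [this] at h2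
    exact absurd h2 (not_le.2 h3)
  · refine ae_restrict_of_ae ?_
    filter_upwards [h, hκ] with ω h2 h3
    exact h3.le.trans h2
  · exact integrable_condExp.integrableOn

/-! ### The market with a nonnegative utility: pasting and integrability. -/

noncomputable section Model

variable {Ω : Type*} {𝒢 mΩ : MeasurableSpace Ω} {P : Measure Ω} {d : ℕ}
  {Y : Ω → EuclideanSpace ℝ (Fin d)} {U : ℝ → Ω → ℝ≥0∞}

/-- The conditional expectation of `U` at the terminal wealth `H + ⟨ξ, Y⟩`. -/
def gain (𝒢 : MeasurableSpace Ω) [mΩ : MeasurableSpace Ω] (P : Measure Ω)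
    (Y : Ω → EuclideanSpace ℝ (Fin d)) (U : ℝ → Ω → ℝ≥0∞) (H : Ω → ℝ)
    (ξ : Ω → EuclideanSpace ℝ (Fin d)) : Ω → ℝ≥0∞ :=
  condLExp 𝒢 P fun ω => U (H ω + inner ℝ (ξ ω) (Y ω)) ω

/-- Standing assumptions on the market and on a nonnegative random utility `U`. -/
structure IsModel (𝒢 : MeasurableSpace Ω) [mΩ : MeasurableSpace Ω] (P : Measure Ω)
    [IsProbabilityMeasure P] (Y : Ω → EuclideanSpace ℝ (Fin d)) (U : ℝ → Ω → ℝ≥0∞) : Prop where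
  le : 𝒢 ≤ mΩ
  measurable_assets : Measurable Y
  linear_hull : ∀ᵐ ω ∂P, ∃ W : Submodule ℝ (EuclideanSpace ℝ (Fin d)),
    (condAffineHull 𝒢 P Y ω : Set (EuclideanSpace ℝ (Fin d))) = W
  norm_bound : ∃ β : Ω → ℝ, Measurable[𝒢] β ∧ (∀ᵐ ω ∂P, 0 < β ω) ∧
    ∀ H : Ω → ℝ, Measurable[𝒢] H → ∀ ξ ∈ admissible 𝒢 P Y H ∩ hullValued 𝒢 P Y,
      ∀ᵐ ω ∂P, β ω * ‖ξ ω‖ ≤ H ω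
  measurable : ∀ x, Measurable (U x)
  continuous : ∀ ω, Continuous fun x => U x ω
  monotone : ∀ ω, Monotone fun x => U x ω
  growth : ∀ k : ℕ, 0 < k → ∃ (c : ℝ≥0∞) (C : Ω → ℝ≥0∞), c < ∞ ∧ Measurable C ∧
    (∀ᵐ ω ∂P, condLExp 𝒢 P C ω < ∞) ∧ ∀ᵐ ω ∂P, ∀ x : ℝ, 0 ≤ x → U (k * x) ω ≤ c * U x ω + C ω
  gain_one_lt_top : ∀ ξ ∈ admissible 𝒢 P Y (fun _ => 1), ∀ᵐ ω ∂P, gain 𝒢 P Y U (fun _ => 1) ξ ω < ∞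

theorem measurable_gain (H : Ω → ℝ) (ξ : Ω → EuclideanSpace ℝ (Fin d)) :
    Measurable[𝒢] (gain 𝒢 P Y U H ξ) := measurable_condLExp _ _ _

theorem admissible_mono {H H' : Ω → ℝ} (h : ∀ᵐ ω ∂P, H ω ≤ H' ω) :
    admissible 𝒢 P Y H ⊆ admissible 𝒢 P Y H' := fun ξ hξ => ⟨hξ.1, by
  filter_upwards [hξ.2, h] with ω h1 h2
  linarith⟩

theorem zero_mem_admissible {H : Ω → ℝ} (h : ∀ᵐ ω ∂P, 0 ≤ H ω) :
    (fun _ => 0) ∈ admissible 𝒢 P Y H := ⟨measurable_const, by simpa using h⟩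

theorem piecewise_mem_admissible {H H' : Ω → ℝ} {ξ ξ' : Ω → EuclideanSpace ℝ (Fin d)}
    {F : Set Ω} [∀ j, Decidable (j ∈ F)] (hF : MeasurableSet[𝒢] F) (hξ : ξ ∈ admissible 𝒢 P Y H)
    (hξ' : ξ' ∈ admissible 𝒢 P Y H') (h : ∀ᵐ ω ∂P, ω ∈ F → H ω ≤ H' ω) :
    F.piecewise ξ ξ' ∈ admissible 𝒢 P Y H' := by
  refine ⟨Measurable.piecewise hF hξ.1 hξ'.1, ?_⟩
  filter_upwards [hξ.2, hξ'.2, h] with ω h1 h2 h3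
  by_cases hω : ω ∈ F
  · simp only [hω, Set.piecewise_eq_of_mem]
    linarith [h3 hω]
  · simpa [hω] using h2

variable [IsProbabilityMeasure P]

theorem piecewise_mem_hullValued {ξ ξ' : Ω → EuclideanSpace ℝ (Fin d)}
    {F : Set Ω} [∀ j, Decidable (j ∈ F)] (hF : MeasurableSet[𝒢] F) (hξ : ξ ∈ hullValued 𝒢 P Y)
    (hξ' : ξ' ∈ hullValued 𝒢 P Y) : F.piecewise ξ ξ' ∈ hullValued 𝒢 P Y := by
  refine ⟨Measurable.piecewise hF hξ.1 hξ'.1, ?_⟩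
  filter_upwards [hξ.2, hξ'.2] with ω h1 h2
  by_cases hω : ω ∈ F
  · simpa [hω] using h1
  · simpa [hω] using h2

namespace IsModel

theorem measurable_comp (hM : IsModel 𝒢 P Y U)
    {X : Ω → ℝ} (hX : Measurable X) : Measurable fun ω => U (X ω) ω :=
  (measurable_uncurry_of_continuous_of_measurable hM.continuous hM.measurable).comp
    (hX.prodMk measurable_id)

theorem measurable_wealth (hM : IsModel 𝒢 P Y U)
    {H : Ω → ℝ} {ξ : Ω → EuclideanSpace ℝ (Fin d)}
    (hH : Measurable[𝒢] H) (hξ : Measurable[𝒢] ξ) :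
    Measurable fun ω => H ω + inner ℝ (ξ ω) (Y ω) :=
  (hH.mono hM.le le_rfl).add ((hξ.mono hM.le le_rfl).inner hM.measurable_assets)

theorem gain_le_on (hM : IsModel 𝒢 P Y U)
    {H H' : Ω → ℝ} {ξ ξ' : Ω → EuclideanSpace ℝ (Fin d)} {F : Set Ω}
    (hF : MeasurableSet[𝒢] F) (h : ∀ᵐ ω ∂P, ω ∈ F → H ω ≤ H' ω)
    (h' : ∀ᵐ ω ∂P, ω ∈ F → (inner ℝ (ξ ω) (Y ω) : ℝ) = inner ℝ (ξ' ω) (Y ω)) :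
    ∀ᵐ ω ∂P, ω ∈ F → gain 𝒢 P Y U H ξ ω ≤ gain 𝒢 P Y U H' ξ' ω := by
  refine condLExp_le_on hM.le hF ?_
  filter_upwards [h, h'] with ω h1 h2 hω
  rw [h2 hω]
  exact hM.monotone ω (by linarith [h1 hω])

theorem condLExp_scale_lt_top (hM : IsModel 𝒢 P Y U)
    {X : Ω → ℝ} (hX : Measurable X) (hX0 : ∀ᵐ ω ∂P, 0 ≤ X ω)
    (h : ∀ᵐ ω ∂P, condLExp 𝒢 P (fun ω => U (X ω) ω) ω < ∞) {k : ℕ} (hk : 0 < k) :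
    ∀ᵐ ω ∂P, condLExp 𝒢 P (fun ω => U (k * X ω) ω) ω < ∞ := by
  obtain ⟨c, C, hc, hC, hCt, hcC⟩ := hM.growth k hk
  have hUX := hM.measurable_comp hX
  have h1 : (fun ω => U (k * X ω) ω) ≤ᵐ[P] (c • fun ω => U (X ω) ω) + C := by
    filter_upwards [hX0, hcC] with ω h1 h2
    simpa using h2 _ h1
  filter_upwards [h, hCt, condLExp_mono (mΩ := 𝒢) h1,
    condLExp_add_right (mΩ := 𝒢) (P := P) (c • fun ω => U (X ω) ω) hC.aemeasurable,
    condLExp_smul (mΩ := 𝒢) (P := P) (fun ω => U (X ω) ω) hUX.aemeasurable c]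
    with ω h2 h3 h4 h5 h6
  refine h4.trans_lt ?_
  rw [h5, Pi.add_apply, h6]
  exact ENNReal.add_lt_top.2 ⟨ENNReal.mul_lt_top hc h2, h3⟩

/-- On `{H ≤ n + 1}` dividing by `n + 1` reduces to initial wealth 1; the growth condition undoes
the scaling, and the random `n` is `⌈H⌉₊`. -/
theorem gain_lt_top (hM : IsModel 𝒢 P Y U)
    {H : Ω → ℝ} (hH : Measurable[𝒢] H) {ξ : Ω → EuclideanSpace ℝ (Fin d)}
    (hξ : ξ ∈ admissible 𝒢 P Y H) : ∀ᵐ ω ∂P, gain 𝒢 P Y U H ξ ω < ∞ := by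
  let F : ℕ → Set Ω := fun n => {ω | H ω ≤ n + 1}
  have hF : ∀ n, MeasurableSet[𝒢] (F n) := fun n => measurableSet_le hH measurable_const
  let ζ : ℕ → Ω → EuclideanSpace ℝ (Fin d) := fun n => (F n).indicator (((n : ℝ) + 1)⁻¹ • ξ)
  have hζ : ∀ n, ζ n ∈ admissible 𝒢 P Y (fun _ => 1) := fun n => by
    refine ⟨(hξ.1.const_smul _).indicator (hF n), ?_⟩
    filter_upwards [hξ.2] with ω h
    by_cases hω : ω ∈ F n
    · have hn : (0 : ℝ) < n + 1 := by positivity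
      have hω' : H ω ≤ n + 1 := hω
      simp only [ζ, hω, Set.indicator_of_mem, Pi.smul_apply, inner_smul_left]
      have : 0 ≤ ((n : ℝ) + 1)⁻¹ * ((n + 1) + inner ℝ (ξ ω) (Y ω)) :=
        mul_nonneg (by positivity) (by linarith)
      rw [mul_add, inv_mul_cancel₀ hn.ne'] at this
      simpa using this
    · simp [ζ, hω]
  have hN : Measurable[𝒢] fun ω => ⌈H ω⌉₊ := Nat.measurable_ceil.comp hH
  refine condLExp_lt_top_of_cover hM.le _ hN
    (fun n ω => U ((n + 1 : ℕ) * (1 + inner ℝ (ζ n ω) (Y ω))) ω) (fun n => ?_) ?_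
  · exact hM.condLExp_scale_lt_top (hM.measurable_wealth measurable_const (hζ n).1) (hζ n).2
      (hM.gain_one_lt_top _ (hζ n)) n.succ_pos
  · refine Eventually.of_forall fun ω => hM.monotone ω ?_
    have h1 : H ω ≤ (⌈H ω⌉₊ : ℝ) + 1 := (Nat.le_ceil _).trans (by linarith)
    have hω : ω ∈ F ⌈H ω⌉₊ := h1
    have hn : (0 : ℝ) < (⌈H ω⌉₊ : ℝ) + 1 := by positivity
    simp only [ζ, hω, Set.indicator_of_mem, Pi.smul_apply, inner_smul_left, Nat.cast_add,
      Nat.cast_one, mul_add]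
    rw [show starRingEnd ℝ (((⌈H ω⌉₊ : ℝ) + 1)⁻¹) = ((⌈H ω⌉₊ : ℝ) + 1)⁻¹ from rfl,
      ← mul_assoc, mul_one]
    rw [mul_inv_cancel₀ hn.ne', one_mul]
    linarith

/-- The payoffs of a pointwise bounded sequence of admissible strategies are dominated. -/
theorem condLExp_iSup_lt_top (hM : IsModel 𝒢 P Y U)
    {H : Ω → ℝ} (hH : Measurable[𝒢] H) (hH0 : ∀ᵐ ω ∂P, 0 ≤ H ω)
    {ξ : ℕ → Ω → EuclideanSpace ℝ (Fin d)} (hξ : ∀ n, ξ n ∈ admissible 𝒢 P Y H)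
    (hb : ∀ᵐ ω ∂P, ∃ B, ∀ n, ‖ξ n ω‖ ≤ B) :
    ∀ᵐ ω ∂P, condLExp 𝒢 P (fun ω => ⨆ n, U (H ω + inner ℝ (ξ n ω) (Y ω)) ω) ω < ∞ := by
  obtain ⟨C, hC, hCle⟩ := @exists_measurable_inner_le_sum Ω 𝒢 d ξ (fun n => (hξ n).1)
  -- With `s` the maximum of `H` and the first `m` wealths, each `|⟨ξ i, Y⟩|` with `i < m` is at
  -- most `2 * s`. Hence every wealth is at most `s + m * (m * (2 * s)) = (1 + 2 * m ^ 2) * s`.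
  let k : ℕ → ℕ := fun m => 1 + 2 * m ^ 2
  have hk : ∀ m, 0 < k m := fun m => by positivity
  let Z : ℕ → Ω → ℝ≥0∞ := fun m => (fun ω => U (k m * H ω) ω) +
    ∑ i ∈ Finset.range m, fun ω => U (k m * (H ω + inner ℝ (ξ i ω) (Y ω))) ω
  have hUm : ∀ m i, Measurable fun ω => U (k m * (H ω + inner ℝ (ξ i ω) (Y ω))) ω := fun m i =>
    hM.measurable_comp ((hM.measurable_wealth hH (hξ i).1).const_mul _)
  have hsum : ∀ m, Measurable
      (∑ i ∈ Finset.range m, fun ω => U (k m * (H ω + inner ℝ (ξ i ω) (Y ω))) ω) := fun m => by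
    rw [Finset.sum_fn]
    exact Finset.measurable_fun_sum _ fun i _ => hUm m i
  have hHfin : ∀ᵐ ω ∂P, condLExp 𝒢 P (fun ω => U (H ω) ω) ω < ∞ := by
    simpa [gain] using hM.gain_lt_top hH (zero_mem_admissible hH0)
  refine condLExp_lt_top_of_cover hM.le C hC Z (fun m => ?_) ?_
  · have h1 : ∀ i, ∀ᵐ ω ∂P,
        condLExp 𝒢 P (fun ω => U (k m * (H ω + inner ℝ (ξ i ω) (Y ω))) ω) ω < ∞ := fun i =>
      hM.condLExp_scale_lt_top (hM.measurable_wealth hH (hξ i).1) (hξ i).2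
        (hM.gain_lt_top hH (hξ i)) (hk m)
    filter_upwards [ae_all_iff.2 h1,
      hM.condLExp_scale_lt_top (hH.mono hM.le le_rfl) hH0 hHfin (hk m),
      condLExp_add_right (mΩ := 𝒢) (P := P) (fun ω => U (k m * H ω) ω)
        (hsum m).aemeasurable,
      condLExp_finsetSum (P := P) 𝒢 (Finset.range m) fun i => (hUm m i).aemeasurable]
      with ω h2 h3 h4 h5
    rw [show condLExp 𝒢 P (Z m) ω = _ from h4, Pi.add_apply, h5, Finset.sum_apply]
    exact ENNReal.add_lt_top.2 ⟨h3, ENNReal.sum_lt_top.2 fun i _ => h2 i⟩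
  · filter_upwards [hH0, ae_all_iff.2 fun n => (hξ n).2, hb] with ω h0 h1 h2
    refine iSup_le fun n => ?_
    set m := C ω with hm
    set t : ℕ → ℝ := fun i => H ω + inner ℝ (ξ i ω) (Y ω) with ht
    let s : ℝ := (Finset.range m).fold max (H ω) t
    have hHs : H ω ≤ s := Finset.le_fold_max _ |>.2 (Or.inl le_rfl)
    have hts : ∀ i ∈ Finset.range m, t i ≤ s := fun i hi =>
      Finset.le_fold_max _ |>.2 (Or.inr ⟨i, hi, le_rfl⟩)
    have hsum : ∑ i ∈ Finset.range m, |(inner ℝ (ξ i ω) (Y ω) : ℝ)| ≤ m * (2 * s) := by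
      refine (Finset.sum_le_card_nsmul _ _ (2 * s) fun i hi => ?_).trans_eq (by simp)
      have := hts i hi
      have h3 := h1 i
      simp only [ht] at this
      exact abs_le.2 ⟨by linarith, by linarith⟩
    have htn : t n ≤ k m * s := by
      have h4 := (le_abs_self _).trans (hCle ω h2 n (Y ω))
      have h5 : (m : ℝ) * ∑ i ∈ Finset.range m, |(inner ℝ (ξ i ω) (Y ω) : ℝ)|
        ≤ m * (m * (2 * s)) := by gcongr
      simp only [ht, k]
      push_cast
      nlinarith
    refine (hM.monotone ω htn).trans ?_
    simp only [Z, Pi.add_apply, Finset.sum_apply]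
    -- The maximum is attained, so `U` at `k m * s` is one of the summands of `Z m`.
    have hs : s = H ω ∨ ∃ i ∈ Finset.range m, s = t i := by
      rcases (Finset.le_fold_max s).1 (le_refl s) with h | ⟨i, hi, h⟩
      · exact Or.inl (le_antisymm h hHs)
      · exact Or.inr ⟨i, hi, le_antisymm h (hts i hi)⟩
    rcases hs with h | ⟨i, hi, h⟩
    · rw [h]; exact le_self_add
    · rw [h]
      exact (Finset.single_le_sum (f := fun i => U (k m * t i) ω) (fun _ _ => zero_le) hi).trans
        le_add_self

end IsModel

end Model

/-! ### Limit strategies and existence of an optimal strategy. -/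

noncomputable section Maximizer

variable {Ω : Type*} {𝒢 mΩ : MeasurableSpace Ω} {P : Measure Ω} {d : ℕ}
  {Y : Ω → EuclideanSpace ℝ (Fin d)} {U : ℝ → Ω → ℝ≥0∞} [IsProbabilityMeasure P]

theorem isClosed_condAffineHull (ω : Ω) :
    IsClosed (condAffineHull 𝒢 P Y ω : Set (EuclideanSpace ℝ (Fin d))) :=
  AffineSubspace.closed_of_finiteDimensional _

namespace IsModel

theorem zero_mem_hullValued (hM : IsModel 𝒢 P Y U) : (fun _ => 0) ∈ hullValued 𝒢 P Y := by
  refine ⟨measurable_const, ?_⟩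
  filter_upwards [hM.linear_hull] with ω ⟨W, hW⟩
  rw [← SetLike.mem_coe, hW]
  exact W.zero_mem

/-- Strategies for the wealths `H n` have a limit point which is a strategy for `lim H n` and at
which the gain does not drop. -/
theorem exists_limit_strategy (hM : IsModel 𝒢 P Y U)
    {H : ℕ → Ω → ℝ} {H' K : Ω → ℝ} (hH : ∀ n, Measurable[𝒢] (H n))
    (hH' : Measurable[𝒢] H') (hK : Measurable[𝒢] K) (hH0 : ∀ n, ∀ᵐ ω ∂P, 0 ≤ H n ω)
    (hHK : ∀ n, ∀ᵐ ω ∂P, H n ω ≤ K ω)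
    (hlim : ∀ᵐ ω ∂P, Tendsto (fun n => H n ω) atTop (𝓝 (H' ω)))
    {ξ : ℕ → Ω → EuclideanSpace ℝ (Fin d)}
    (hξ : ∀ n, ξ n ∈ admissible 𝒢 P Y (H n) ∩ hullValued 𝒢 P Y) :
    ∃ ζ ∈ admissible 𝒢 P Y H' ∩ hullValued 𝒢 P Y, ∀ᵐ ω ∂P,
      liminf (fun n => gain 𝒢 P Y U (H n) (ξ n) ω) atTop ≤ gain 𝒢 P Y U H' ζ ω := by
  obtain ⟨β, hβm, hβ, hβb⟩ := hM.norm_bound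
  have hξm : ∀ n, Measurable[𝒢] (ξ n) := fun n => (hξ n).1.1
  have hb : ∀ᵐ ω ∂P, ∃ B, ∀ n, ‖ξ n ω‖ ≤ B := by
    filter_upwards [hβ, ae_all_iff.2 fun n => hβb (H n) (hH n) (ξ n) (hξ n), ae_all_iff.2 hHK]
      with ω h1 h2 h3
    refine ⟨K ω / β ω, fun n => (le_div_iff₀' h1).2 ((h2 n).trans (h3 n))⟩
  obtain ⟨ψ, ζ, hψm, hψ, hζm, hζ⟩ := @exists_random_subseq Ω 𝒢 d ξ hξm
  have hconv : ∀ᵐ ω ∂P, Tendsto (fun k => H (ψ k ω) ω + inner ℝ (ξ (ψ k ω) ω) (Y ω)) atTop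
      (𝓝 (H' ω + inner ℝ (ζ ω) (Y ω))) := by
    filter_upwards [hb, hlim] with ω h1 h2
    exact (h2.comp (hψ ω).tendsto_atTop).add ((hζ ω h1).inner tendsto_const_nhds)
  have hζS : ζ ∈ admissible 𝒢 P Y H' ∩ hullValued 𝒢 P Y := by
    refine ⟨⟨hζm, ?_⟩, hζm, ?_⟩
    · filter_upwards [hconv, ae_all_iff.2 fun n => (hξ n).1.2] with ω h1 h2
      exact ge_of_tendsto' h1 fun k => h2 _
    · filter_upwards [hb, ae_all_iff.2 fun n => (hξ n).2.2] with ω h1 h2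
      exact (isClosed_condAffineHull ω).mem_of_tendsto (hζ ω h1)
        (Eventually.of_forall fun k => h2 _)
  refine ⟨ζ, hζS, ?_⟩
  have hK0 : ∀ᵐ ω ∂P, 0 ≤ K ω := by
    filter_upwards [hH0 0, hHK 0] with ω h1 h2
    exact h1.trans h2
  let X : ℕ → Ω → ℝ≥0∞ := fun n ω => U (H n ω + inner ℝ (ξ n ω) (Y ω)) ω
  have hX : ∀ n, Measurable (X n) := fun n =>
    hM.measurable_comp (hM.measurable_wealth (hH n) (hξm n))
  have hWm : Measurable fun ω => ⨆ n, U (K ω + inner ℝ (ξ n ω) (Y ω)) ω :=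
    Measurable.iSup fun n => hM.measurable_comp (hM.measurable_wealth hK (hξm n))
  have key := liminf_condLExp_le_of_tendsto (P := P) hM.le
    (X := fun k ω => X (ψ k ω) ω)
    (fun k => measurable_comp_index hX ((hψm k).mono hM.le le_rfl))
    (hM.measurable_comp (hM.measurable_wealth hH' hζm)) hWm
    (hM.condLExp_iSup_lt_top hK hK0 (fun n => admissible_mono (hHK n) (hξ n).1) hb)
    (fun k => by
      filter_upwards [ae_all_iff.2 hHK] with ω h
      refine le_trans (hM.monotone ω ?_)
        (le_iSup (fun n => U (K ω + inner ℝ (ξ n ω) (Y ω)) ω) (ψ k ω))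
      linarith [h (ψ k ω)])
    (by
      filter_upwards [hconv] with ω h
      exact ((hM.continuous ω).tendsto _).comp h)
  filter_upwards [key, ae_all_iff.2 fun k => condLExp_random_index (P := P) hM.le X (hψm k)]
    with ω h1 h2
  refine le_trans ?_ h1
  simp_rw [h2]
  -- The liminf along the random subsequence dominates the liminf of the full sequence.
  exact (liminf_le_liminf_of_le (g := map (fun k => ψ k ω) atTop) (hψ ω).tendsto_atTop
    (u := fun n => condLExp 𝒢 P (X n) ω)).trans_eq rfl

/-- Gains are upward directed: on each of two complementary `𝒢`-events, the better strategy is used.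
-/
theorem exists_gain_ge_both (hM : IsModel 𝒢 P Y U)
    {H : Ω → ℝ} {ξ ξ' : Ω → EuclideanSpace ℝ (Fin d)}
    (hξ : ξ ∈ admissible 𝒢 P Y H ∩ hullValued 𝒢 P Y)
    (hξ' : ξ' ∈ admissible 𝒢 P Y H ∩ hullValued 𝒢 P Y) :
    ∃ ζ ∈ admissible 𝒢 P Y H ∩ hullValued 𝒢 P Y, ∀ᵐ ω ∂P,
      gain 𝒢 P Y U H ξ ω ≤ gain 𝒢 P Y U H ζ ω ∧ gain 𝒢 P Y U H ξ' ω ≤ gain 𝒢 P Y U H ζ ω := by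
  classical
  let F : Set Ω := {ω | gain 𝒢 P Y U H ξ' ω ≤ gain 𝒢 P Y U H ξ ω}
  have hF : MeasurableSet[𝒢] F := measurableSet_le (measurable_gain H ξ') (measurable_gain H ξ)
  refine ⟨F.piecewise ξ ξ', ⟨piecewise_mem_admissible hF hξ.1 hξ'.1
    (Eventually.of_forall fun _ _ => le_rfl), piecewise_mem_hullValued hF hξ.2 hξ'.2⟩, ?_⟩
  filter_upwards [hM.gain_le_on (H := H) (H' := H) (ξ := ξ) (ξ' := F.piecewise ξ ξ') hF
      (Eventually.of_forall fun _ _ => le_rfl)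
      (Eventually.of_forall fun ω hω => by simp [hω]),
    hM.gain_le_on (H := H) (H' := H) (ξ := ξ') (ξ' := F.piecewise ξ ξ') hF.compl
      (Eventually.of_forall fun _ _ => le_rfl)
      (Eventually.of_forall fun ω hω => by simp [show ω ∉ F from hω])] with ω h1 h2
  by_cases hω : ω ∈ F
  · exact ⟨h1 hω, le_trans hω (h1 hω)⟩
  · exact ⟨le_trans (not_le.1 hω).le (h2 hω), h2 hω⟩

/-- The optimal strategy at a random initial wealth. -/
theorem exists_maximizer (hM : IsModel 𝒢 P Y U)
    {H : Ω → ℝ} (hH : Measurable[𝒢] H) (hH0 : ∀ᵐ ω ∂P, 0 ≤ H ω) :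
    ∃ ζ ∈ admissible 𝒢 P Y H ∩ hullValued 𝒢 P Y, ∀ ξ ∈ admissible 𝒢 P Y H,
      ∀ᵐ ω ∂P, gain 𝒢 P Y U H ξ ω ≤ gain 𝒢 P Y U H ζ ω := by
  let S := admissible 𝒢 P Y H ∩ hullValued 𝒢 P Y
  let g : (Ω → EuclideanSpace ℝ (Fin d)) → Ω → ℝ≥0∞ := gain 𝒢 P Y U H
  -- A bounded, strictly decreasing functional of the gain: its infimum is finite with no
  -- integrability of the gains, and its minimizers are the maximal gains.
  let J : (Ω → EuclideanSpace ℝ (Fin d)) → ℝ≥0∞ := fun ξ => ∫⁻ ω, (1 + g ξ ω)⁻¹ ∂P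
  have hJmono : ∀ ξ ξ', (∀ᵐ ω ∂P, g ξ ω ≤ g ξ' ω) → J ξ' ≤ J ξ := fun ξ ξ' h =>
    lintegral_mono_ae (h.mono fun ω hω => ENNReal.inv_le_inv.2 (by gcongr))
  have hne : (J '' S).Nonempty :=
    ⟨_, _, ⟨zero_mem_admissible hH0, hM.zero_mem_hullValued⟩, rfl⟩
  obtain ⟨a, -, halim, haS⟩ := exists_seq_tendsto_sInf hne (OrderBot.bddBelow _)
  choose ξ hξS hξJ using haS
  choose! join hjoinS hjoin using fun ξ (hξ : ξ ∈ S) ξ' (hξ' : ξ' ∈ S) =>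
    hM.exists_gain_ge_both hξ hξ'
  let η : ℕ → Ω → EuclideanSpace ℝ (Fin d) := fun n =>
    Nat.rec (ξ 0) (fun n e => join e (ξ (n + 1))) n
  have hηsucc : ∀ n, η (n + 1) = join (η n) (ξ (n + 1)) := fun _ => rfl
  have hηS : ∀ n, η n ∈ S := fun n => by
    induction n with
    | zero => exact hξS 0
    | succ n ih => exact hjoinS _ ih _ (hξS _)
  have hηmono : ∀ᵐ ω ∂P, Monotone fun n => g (η n) ω := by
    filter_upwards [ae_all_iff.2 fun n => hjoin _ (hηS n) _ (hξS (n + 1))] with ω h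
    exact monotone_nat_of_le_succ fun n => (h n).1
  have hηξ : ∀ n, ∀ᵐ ω ∂P, g (ξ n) ω ≤ g (η n) ω := fun n => by
    cases n with
    | zero => exact Eventually.of_forall fun _ => le_rfl
    | succ n => exact (hjoin _ (hηS n) _ (hξS (n + 1))).mono fun ω h => h.2
  obtain ⟨ζ, hζS, hζ⟩ := hM.exists_limit_strategy (H := fun _ => H) (K := H) (fun _ => hH) hH hH
    (fun _ => hH0) (fun _ => Eventually.of_forall fun _ => le_rfl)
    (Eventually.of_forall fun _ => tendsto_const_nhds) hηS
  have hζη : ∀ n, ∀ᵐ ω ∂P, g (η n) ω ≤ g ζ ω := fun n => by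
    filter_upwards [hζ, hηmono] with ω h1 h2
    refine le_trans (le_liminf_of_le ?_ ?_) h1
    · isBoundedDefault
    · exact (eventually_ge_atTop n).mono fun m hm => h2 hm
  have hζJ : J ζ ≤ sInf (J '' S) := ge_of_tendsto' halim fun n => by
    rw [← hξJ n]
    exact (hJmono _ _ (hζη n)).trans (hJmono _ _ (hηξ n))
  have hopt : ∀ ξ ∈ S, ∀ᵐ ω ∂P, g ξ ω ≤ g ζ ω := fun ξ hξ => by
    obtain ⟨χ, hχS, hχ⟩ := hM.exists_gain_ge_both hξ hζS
    have h1 : J ζ ≤ J χ := hζJ.trans (sInf_le ⟨χ, hχS, rfl⟩)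
    have hm : ∀ ξ, Measurable fun ω => (1 + g ξ ω)⁻¹ := fun ξ =>
      (((measurable_gain (P := P) H ξ).mono hM.le le_rfl).const_add 1).inv
    have hfin : J χ ≠ ∞ := by
      refine ne_top_of_le_ne_top (b := 1) (by simp) ?_
      refine (lintegral_mono (g := fun _ => 1) fun ω => ?_).trans_eq (by simp)
      exact ENNReal.inv_le_one.2 le_self_add
    -- Since `χ` gains at least as much as `ζ` but cannot lower `J`, the two gains agree almost
    -- surely.
    have h2 := ae_eq_of_ae_le_of_lintegral_le (f := fun ω => (1 + g χ ω)⁻¹)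
      (g := fun ω => (1 + g ζ ω)⁻¹) (hχ.mono fun ω h => ENNReal.inv_le_inv.2 (by gcongr; exact h.2))
      hfin (hm ζ).aemeasurable h1
    filter_upwards [h2, hχ] with ω h3 h4
    have h5 : 1 + g χ ω = 1 + g ζ ω := inv_injective h3
    have h6 : g χ ω = g ζ ω := (ENNReal.add_right_inj (by simp)).1 h5
    exact h4.1.trans_eq h6
  refine ⟨ζ, hζS, fun ξ hξ => ?_⟩
  obtain ⟨η, hηD, hηeq⟩ := exists_hullValued hM.le hM.measurable_assets hM.linear_hull hξ.1
  have hηS : η ∈ S := ⟨⟨hηD.1, by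
    filter_upwards [hξ.2, hηeq] with ω h1 h2
    rwa [h2]⟩, hηD⟩
  filter_upwards [hopt η hηS, hM.gain_le_on (H := H) (H' := H) (ξ := ξ) (ξ' := η)
    MeasurableSet.univ (Eventually.of_forall fun _ _ => le_rfl)
    (hηeq.mono fun ω h _ => h.symm)] with ω h1 h2
  exact (h2 trivial).trans h1

/-- Comparison of optimal gains on the event that one initial wealth is below the other. -/
theorem maximal_gain_le_on (hM : IsModel 𝒢 P Y U)
    {H H' : Ω → ℝ} (hH : Measurable[𝒢] H) (hH' : Measurable[𝒢] H')
    {ζ ζ' : Ω → EuclideanSpace ℝ (Fin d)} (hζ : ζ ∈ admissible 𝒢 P Y H)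
    (hζ' : ζ' ∈ admissible 𝒢 P Y H')
    (hmax : ∀ ξ ∈ admissible 𝒢 P Y H', ∀ᵐ ω ∂P, gain 𝒢 P Y U H' ξ ω ≤ gain 𝒢 P Y U H' ζ' ω) :
    ∀ᵐ ω ∂P, H ω ≤ H' ω → gain 𝒢 P Y U H ζ ω ≤ gain 𝒢 P Y U H' ζ' ω := by
  classical
  let F : Set Ω := {ω | H ω ≤ H' ω}
  have hF : MeasurableSet[𝒢] F := measurableSet_le hH hH'
  have h := piecewise_mem_admissible hF hζ hζ' (Eventually.of_forall fun _ hω => hω)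
  filter_upwards [hmax _ h, hM.gain_le_on (H := H) (H' := H') (ξ := ζ) (ξ' := F.piecewise ζ ζ') hF
      (Eventually.of_forall fun _ hω => hω)
      (Eventually.of_forall fun ω hω => by simp [hω])] with ω h1 h2 hω
  exact (h2 hω).trans h1

end IsModel

end Maximizer

/-! ### A regular version of the optimal gain. -/

noncomputable section Value

section Regularization

variable {Ω : Type*}

/-- The right-continuous regularization of a process indexed by the rationals. -/
def rightInf (a : ℚ → Ω → ℝ≥0∞) (x : ℝ) (ω : Ω) : ℝ≥0∞ := ⨅ q : ℚ, if x < q then a q ω else ∞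

theorem rightInf_le (a : ℚ → Ω → ℝ≥0∞) {x : ℝ} {q : ℚ} (h : x < q) (ω : Ω) :
    rightInf a x ω ≤ a q ω := (iInf_le _ q).trans_eq (if_pos h)

theorem monotone_rightInf (a : ℚ → Ω → ℝ≥0∞) (ω : Ω) : Monotone fun x => rightInf a x ω :=
  fun x y hxy => le_iInf fun q => by
    split_ifs with h
    · exact rightInf_le a (hxy.trans_lt h) ω
    · exact le_top

theorem measurable_rightInf {m : MeasurableSpace Ω} {a : ℚ → Ω → ℝ≥0∞}
    (ha : ∀ q, Measurable (a q)) : Measurable fun p : ℝ × Ω => rightInf a p.1 p.2 :=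
  Measurable.iInf fun q => Measurable.ite (measurableSet_lt measurable_fst measurable_const)
    ((ha q).comp measurable_snd) measurable_const

/-- Right continuity is built into the infimum over larger rationals, so only the absence of left
jumps is assumed. -/
theorem continuousOn_rightInf {a : ℚ → Ω → ℝ≥0∞} {ω : Ω}
    (h : ∀ x > 0, ∀ c < rightInf a x ω, ∃ y < x, c < rightInf a y ω) :
    ContinuousOn (fun x => rightInf a x ω) (Set.Ici 0) := fun x hx => by
  refine tendsto_order.2 ⟨fun c hc => ?_, fun c hc => ?_⟩
  · rcases (Set.mem_Ici.1 hx).eq_or_lt with rfl | hx0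
    · filter_upwards [self_mem_nhdsWithin] with y hy
      exact hc.trans_le (monotone_rightInf a ω hy)
    · obtain ⟨y, hyx, hy⟩ := h x hx0 c hc
      filter_upwards [nhdsWithin_le_nhds (Ioi_mem_nhds hyx)] with z hz
      exact hy.trans_le (monotone_rightInf a ω (Set.mem_Ioi.1 hz).le)
  · obtain ⟨q, hq⟩ := iInf_lt_iff.1 hc
    split_ifs at hq with hxq
    · filter_upwards [nhdsWithin_le_nhds (Iio_mem_nhds hxq)] with z hz
      exact (rightInf_le a hz ω).trans_lt hq
    · exact absurd hq not_top_lt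

/-- The level `c` crossing time of the paths of `g`. -/
def crossing (g : ℝ → Ω → ℝ≥0∞) (c : ℝ≥0∞) (ω : Ω) : ℝ :=
  (⨆ q : ℚ, if g q ω ≤ c then ENNReal.ofReal q else 0).toReal

theorem measurable_crossing {m : MeasurableSpace Ω} {g : ℝ → Ω → ℝ≥0∞}
    (hg : ∀ x, Measurable (g x)) (c : ℝ≥0∞) : Measurable (crossing g c) :=
  (Measurable.iSup fun q : ℚ => Measurable.ite (measurableSet_le (hg q) measurable_const)
    measurable_const measurable_const).ennreal_toReal

/-- This makes the location of a path's jump across the level `c` a measurable function of `ω`. -/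
theorem crossing_eq {g : ℝ → Ω → ℝ≥0∞} {c : ℝ≥0∞} {ω : Ω} (hg : Monotone fun x => g x ω) {x : ℝ}
    (hx : 0 < x) (hlt : ∀ y < x, g y ω ≤ c) (hc : c < g x ω) : crossing g c ω = x := by
  have : (⨆ q : ℚ, if g q ω ≤ c then ENNReal.ofReal q else 0) = ENNReal.ofReal x := by
    refine le_antisymm (iSup_le fun q => ?_) (le_of_forall_lt fun r hr => ?_)
    · split_ifs with h
      · refine ENNReal.ofReal_le_ofReal (le_of_not_gt fun hxq => ?_)
        exact absurd ((hg hxq.le).trans h) (not_le.2 hc)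
      · exact zero_le
    · have hr' : r.toReal < x := (ENNReal.lt_ofReal_iff_toReal_lt hr.ne_top).1 hr
      obtain ⟨q, hrq, hqx⟩ := exists_rat_btwn hr'
      refine lt_of_lt_of_le ((ENNReal.lt_ofReal_iff_toReal_lt hr.ne_top).2 hrq) ?_
      refine le_trans (le_of_eq ?_) (le_iSup _ q)
      rw [if_pos (hlt q hqx)]
  rw [crossing, this, ENNReal.toReal_ofReal hx.le]

end Regularization

variable {Ω : Type*} {𝒢 mΩ : MeasurableSpace Ω} {P : Measure Ω} {d : ℕ}
  {Y : Ω → EuclideanSpace ℝ (Fin d)} {U : ℝ → Ω → ℝ≥0∞} [IsProbabilityMeasure P]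

/-- The smallest point of the grid of mesh `1 / (n + 1)` which lies strictly above `x ≥ 0`. -/
def gridAbove (n : ℕ) (x : ℝ) : ℚ := (⌊((n : ℝ) + 1) * x⌋₊ + 1) / (n + 1)

theorem cast_gridAbove (n : ℕ) (x : ℝ) :
    (gridAbove n x : ℝ) = (⌊((n : ℝ) + 1) * x⌋₊ + 1) / (n + 1) := by
  simp [gridAbove]

theorem lt_gridAbove (n : ℕ) (x : ℝ) : x < gridAbove n x := by
  rw [cast_gridAbove, lt_div_iff₀' (by positivity)]
  exact Nat.lt_floor_add_one _

theorem gridAbove_le (n : ℕ) {x : ℝ} (hx : 0 ≤ x) : (gridAbove n x : ℝ) ≤ x + 1 / (n + 1) := by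
  have hn : (0 : ℝ) < n + 1 := by positivity
  rw [cast_gridAbove, add_div]
  gcongr
  rw [div_le_iff₀' hn]
  exact Nat.floor_le (by positivity)

theorem tendsto_gridAbove {x : ℝ} (hx : 0 ≤ x) :
    Tendsto (fun n => (gridAbove n x : ℝ)) atTop (𝓝 x) := by
  refine tendsto_of_tendsto_of_tendsto_of_le_of_le tendsto_const_nhds ?_
    (fun n => (lt_gridAbove n x).le) (fun n => gridAbove_le n hx)
  simpa using tendsto_const_nhds.add (tendsto_one_div_add_atTop_nhds_zero_nat (𝕜 := ℝ))

theorem measurable_gridAbove (n : ℕ) : Measurable fun x => (gridAbove n x : ℝ) := by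
  simp_rw [cast_gridAbove]
  fun_prop

namespace IsModel

/-- Scaling wealth and strategy together scales terminal wealth, so Fatou applies with no dominating
function. -/
theorem gain_scale_le_liminf (hM : IsModel 𝒢 P Y U)
    {H : Ω → ℝ} (hH : Measurable[𝒢] H)
    {ξ : Ω → EuclideanSpace ℝ (Fin d)} (hξ : Measurable[𝒢] ξ) {r : ℕ → ℝ}
    (hr : Tendsto r atTop (𝓝 1)) :
    ∀ᵐ ω ∂P, gain 𝒢 P Y U H ξ ω ≤
      liminf (fun n => gain 𝒢 P Y U (fun ω => r n * H ω) (r n • ξ) ω) atTop := by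
  have h1 : (fun ω => U (H ω + inner ℝ (ξ ω) (Y ω)) ω) =ᵐ[P]
      fun ω => liminf (fun n => U (r n * H ω + inner ℝ ((r n • ξ) ω) (Y ω)) ω) atTop := by
    refine Eventually.of_forall fun ω => (Tendsto.liminf_eq ?_).symm
    refine ((hM.continuous ω).tendsto _).comp ?_
    have h2 : Tendsto (fun n => r n * (H ω + inner ℝ (ξ ω) (Y ω))) atTop
        (𝓝 (1 * (H ω + inner ℝ (ξ ω) (Y ω)))) := hr.mul_const _
    simpa [inner_smul_left, mul_add] using h2
  filter_upwards [condLExp_congr_ae (mΩ := 𝒢) h1, condLExp_liminf_le (P := P) hM.le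
    (X := fun n ω => U (r n * H ω + inner ℝ ((r n • ξ) ω) (Y ω)) ω)
    fun n => hM.measurable_comp (hM.measurable_wealth (hH.const_mul _) (hξ.const_smul _))]
    with ω h2 h3
  rw [gain, h2]
  exact h3

/-- The optimal gain as a regular function of the initial wealth. -/
theorem exists_value (hM : IsModel 𝒢 P Y U) : ∃ g : ℝ → Ω → ℝ≥0∞,
    Measurable[MeasurableSpace.prod inferInstance 𝒢] (fun p : ℝ × Ω => g p.1 p.2) ∧
    (∀ᵐ ω ∂P, (∀ x, g x ω < ∞) ∧ Monotone (fun x => g x ω) ∧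
      ContinuousOn (fun x => g x ω) (Set.Ici 0)) ∧
    ∀ H : Ω → ℝ, Measurable[𝒢] H → (∀ᵐ ω ∂P, 0 ≤ H ω) →
      ∃ ζ ∈ admissible 𝒢 P Y H ∩ hullValued 𝒢 P Y,
        (∀ᵐ ω ∂P, g (H ω) ω = gain 𝒢 P Y U H ζ ω) ∧
        ∀ ξ ∈ admissible 𝒢 P Y H, ∀ᵐ ω ∂P, gain 𝒢 P Y U H ξ ω ≤ gain 𝒢 P Y U H ζ ω := by
  choose! Z hZS hZ using fun (H : Ω → ℝ) (hH : Measurable[𝒢] H) (h0 : ∀ᵐ ω ∂P, 0 ≤ H ω) =>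
    hM.exists_maximizer hH h0
  let A : (Ω → ℝ) → Ω → ℝ≥0∞ := fun H => gain 𝒢 P Y U H (Z H)
  have hle : ∀ H H', Measurable[𝒢] H → Measurable[𝒢] H' → (∀ᵐ ω ∂P, 0 ≤ H ω) →
      (∀ᵐ ω ∂P, 0 ≤ H' ω) → ∀ᵐ ω ∂P, H ω ≤ H' ω → A H ω ≤ A H' ω :=
    fun H H' hH hH' h0 h0' => hM.maximal_gain_le_on hH hH' (hZS H hH h0).1 (hZS H' hH' h0').1
      (hZ H' hH' h0')
  -- Negative rationals are sent to wealth 0, where strategies are admissible.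
  let a : ℚ → Ω → ℝ≥0∞ := fun q => A fun _ => max q 0
  have ham : ∀ q, Measurable[𝒢] (a q) := fun q => measurable_gain _ _
  have hq0 : ∀ q : ℚ, ∀ᵐ ω ∂P, 0 ≤ (fun _ : Ω => max (q : ℝ) 0) ω := fun q =>
    Eventually.of_forall fun _ => le_max_right _ _
  let g := rightInf a
  have hgA : ∀ H, Measurable[𝒢] H → (∀ᵐ ω ∂P, 0 ≤ H ω) → ∀ᵐ ω ∂P, g (H ω) ω = A H ω := by
    intro H hH h0
    have hge : ∀ᵐ ω ∂P, A H ω ≤ g (H ω) ω := by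
      filter_upwards [ae_all_iff.2 fun q : ℚ => hle H (fun _ => max (q : ℝ) 0) hH
        measurable_const h0 (hq0 q)] with ω h
      refine le_iInf fun q => ?_
      split_ifs with hq
      · exact h q (hq.le.trans (le_max_left _ _))
      · exact le_top
    -- The grid points are strictly above `H`, as `rightInf` requires, and rational, so one null set
    -- covers all their values.
    let Hn : ℕ → Ω → ℝ := fun n ω => gridAbove n (H ω)
    have hHn : ∀ n, Measurable[𝒢] (Hn n) := fun n => (measurable_gridAbove n).comp hH
    have hHn0 : ∀ n, ∀ᵐ ω ∂P, 0 ≤ Hn n ω := fun n =>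
      h0.mono fun ω h => h.trans (lt_gridAbove n _).le
    obtain ⟨ζ, hζS, hζ⟩ := hM.exists_limit_strategy (K := fun ω => H ω + 1) hHn hH
      (hH.add_const 1) hHn0
      (fun n => h0.mono fun ω h => (gridAbove_le n h).trans (by
        gcongr
        rw [div_le_one (by positivity)]
        linarith [(Nat.cast_nonneg n : (0 : ℝ) ≤ n)]))
      (h0.mono fun ω h => tendsto_gridAbove h) fun n => hZS (Hn n) (hHn n) (hHn0 n)
    filter_upwards [hge, hζ, hZ H hH h0 ζ hζS.1, h0,
      ae_all_iff.2 fun n => ae_all_iff.2 fun q : ℚ => hle (fun _ => max (q : ℝ) 0) (Hn n)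
        measurable_const (hHn n) (hq0 q) (hHn0 n)] with ω h1 h2 h3 h4 h5
    refine le_antisymm (le_trans (le_liminf_of_le ?_ ?_) (h2.trans h3)) h1
    · isBoundedDefault
    · refine Eventually.of_forall fun n => (rightInf_le a (lt_gridAbove n _) ω).trans ?_
      refine h5 n (gridAbove n (H ω)) (max_le le_rfl ?_)
      exact h4.trans (lt_gridAbove n _).le
  have hgm := @measurable_rightInf Ω 𝒢 a ham
  have hgx : ∀ x, Measurable[𝒢] (g x) := fun x => hgm.comp measurable_prodMk_left
  refine ⟨g, hgm, ?_, fun H hH h0 => ⟨Z H, hZS H hH h0, hgA H hH h0, hZ H hH h0⟩⟩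
  have hfin : ∀ n : ℕ, ∀ᵐ ω ∂P, g n ω < ∞ := fun n => by
    have hn0 : ∀ᵐ ω ∂P, 0 ≤ (fun _ : Ω => (n : ℝ)) ω := Eventually.of_forall fun _ => by positivity
    filter_upwards [hgA (fun _ => n) measurable_const hn0,
      hM.gain_lt_top measurable_const (hZS _ measurable_const hn0).1] with ω h1 h2
    rw [h1]
    exact h2
  let r : ℕ → ℝ := fun n => 1 - 1 / ((n : ℝ) + 1)
  have hr : Tendsto r atTop (𝓝 1) := by
    simpa [r] using (tendsto_const_nhds (x := (1 : ℝ))).sub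
      (tendsto_one_div_add_atTop_nhds_zero_nat (𝕜 := ℝ))
  have hr0 : ∀ n, 0 ≤ r n := fun n => by
    rw [sub_nonneg, div_le_one (by positivity)]
    linarith [(Nat.cast_nonneg n : (0 : ℝ) ≤ n)]
  have hr1 : ∀ n, r n < 1 := fun n => by
    have : 0 < 1 / ((n : ℝ) + 1) := by positivity
    linarith
  have hleft : ∀ T : Ω → ℝ, Measurable[𝒢] T → (∀ ω, 0 ≤ T ω) →
      ∀ᵐ ω ∂P, g (T ω) ω ≤ liminf (fun n => g (r n * T ω) ω) atTop := by
    intro T hT hT0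
    have hT0' : ∀ᵐ ω ∂P, 0 ≤ T ω := Eventually.of_forall hT0
    have hrT : ∀ n, Measurable[𝒢] fun ω => r n * T ω := fun n => hT.const_mul _
    have hrT0 : ∀ n, ∀ᵐ ω ∂P, 0 ≤ (fun ω => r n * T ω) ω := fun n =>
      Eventually.of_forall fun ω => mul_nonneg (hr0 n) (hT0 ω)
    have hadm : ∀ n, r n • Z T ∈ admissible 𝒢 P Y fun ω => r n * T ω := fun n => by
      refine ⟨(hZS T hT hT0').1.1.const_smul _, ?_⟩
      filter_upwards [(hZS T hT hT0').1.2] with ω h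
      have := mul_nonneg (hr0 n) h
      simpa [inner_smul_left, mul_add] using this
    filter_upwards [hgA T hT hT0', hM.gain_scale_le_liminf hT (hZS T hT hT0').1.1 hr,
      ae_all_iff.2 fun n => hgA _ (hrT n) (hrT0 n),
      ae_all_iff.2 fun n => hZ _ (hrT n) (hrT0 n) _ (hadm n)] with ω h1 h2 h3 h4
    rw [h1]
    refine h2.trans (liminf_le_liminf (Eventually.of_forall fun n => ?_))
    change _ ≤ g (r n * T ω) ω
    rw [h3]
    exact h4 n
  -- The null set in `hleft` depends on `T`; only the crossing times of countably many rational
  -- levels are needed.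
  filter_upwards [ae_all_iff.2 hfin, ae_all_iff.2 fun q : ℚ =>
    hleft (crossing g (Real.toNNReal q : ℝ≥0∞)) (@measurable_crossing Ω 𝒢 g hgx _)
      fun ω => ENNReal.toReal_nonneg] with ω h1 h2
  refine ⟨fun x => ?_, monotone_rightInf a ω, continuousOn_rightInf fun x hx c hc => ?_⟩
  · obtain ⟨n, hn⟩ := exists_nat_ge x
    exact (monotone_rightInf a ω hn).trans_lt (h1 n)
  · by_contra! hcon
    -- At a left jump at `x`, a rational level inside the gap has crossing time exactly `x`, and
    -- `hleft` there contradicts the gap.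
    obtain ⟨q, -, hcq, hq⟩ := ENNReal.lt_iff_exists_rat_btwn.1 hc
    have h3 := h2 q
    rw [crossing_eq (monotone_rightInf a ω) hx (fun y hy => (hcon y hy).trans hcq.le) hq] at h3
    refine absurd (h3.trans ?_) (not_le.2 hq)
    refine liminf_le_of_frequently_le' (Frequently.of_forall fun n => ?_)
    exact (hcon _ (by nlinarith [hr1 n])).trans hcq.le

end IsModel

end Value

/-! ### Passing between `V` and the shifted utility. -/

noncomputable section Utility

variable {Ω : Type*}

/-- The nonnegative utility `V(x⁺) - V(0)`, set to zero off the event `s`. -/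
def shifted (V : ℝ → Ω → ℝ) (s : Set Ω) (x : ℝ) : Ω → ℝ≥0∞ :=
  s.indicator fun ω => ENNReal.ofReal (V (max x 0) ω - V 0 ω)

/-- The identity `v = (v - w) + w` with negative parts moved across, so that conditional
expectations in `ℝ≥0∞` can be taken termwise. -/
theorem ofReal_add_ofReal_neg {v w : ℝ} (h : w ≤ v) :
    ENNReal.ofReal v + ENNReal.ofReal (-w) =
      (ENNReal.ofReal (v - w) + ENNReal.ofReal w) + ENNReal.ofReal (-v) := by
  rcases le_total 0 v with hv | hv <;> rcases le_total 0 w with hw | hw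
  · rw [ENNReal.ofReal_of_nonpos (neg_nonpos.2 hw), ENNReal.ofReal_of_nonpos (neg_nonpos.2 hv),
      ← ENNReal.ofReal_add (by linarith) hw]
    simp
  · rw [ENNReal.ofReal_of_nonpos hw, ENNReal.ofReal_of_nonpos (neg_nonpos.2 hv),
      ← ENNReal.ofReal_add hv (by linarith)]
    simp [sub_eq_add_neg]
  · obtain rfl : v = 0 := le_antisymm hv (hw.trans h)
    obtain rfl : w = 0 := le_antisymm h hw
    simp
  · rw [ENNReal.ofReal_of_nonpos hw, ENNReal.ofReal_of_nonpos hv, add_zero, zero_add,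
      ← ENNReal.ofReal_add (by linarith) (by linarith)]
    congr 1
    ring

theorem measurable_shifted {m : MeasurableSpace Ω} {V : ℝ → Ω → ℝ} {s : Set Ω}
    (hV : ∀ x : ℝ, 0 ≤ x → Measurable (V x)) (hs : MeasurableSet s) (x : ℝ) :
    Measurable (shifted V s x) :=
  ((hV _ (le_max_right _ _)).sub (hV 0 le_rfl)).ennreal_ofReal.indicator hs

theorem continuous_shifted {V : ℝ → Ω → ℝ} {s : Set Ω}
    (hs : ∀ ω ∈ s, ContinuousOn (fun x => V x ω) (Set.Ici 0)) (ω : Ω) :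
    Continuous fun x => shifted V s x ω := by
  by_cases hω : ω ∈ s
  · simp only [shifted, Set.indicator_of_mem hω]
    refine ENNReal.continuous_ofReal.comp (Continuous.sub ?_ continuous_const)
    exact (hs ω hω).comp_continuous (continuous_id.max continuous_const)
      fun x => Set.mem_Ici.2 (le_max_right _ _)
  · simp only [shifted, Set.indicator_of_notMem hω]
    exact continuous_const

theorem monotone_shifted {V : ℝ → Ω → ℝ} {s : Set Ω}
    (hs : ∀ ω ∈ s, MonotoneOn (fun x => V x ω) (Set.Ici 0)) (ω : Ω) :
    Monotone fun x => shifted V s x ω := fun x y hxy => by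
  by_cases hω : ω ∈ s
  · simp only [shifted, Set.indicator_of_mem hω]
    refine ENNReal.ofReal_le_ofReal (sub_le_sub_right ?_ _)
    exact hs ω hω (Set.mem_Ici.2 (le_max_right _ _)) (Set.mem_Ici.2 (le_max_right _ _))
      (max_le_max_right 0 hxy)
  · simp [shifted, hω]

theorem shifted_of_nonneg {V : ℝ → Ω → ℝ} {s : Set Ω} {x : ℝ} (hx : 0 ≤ x) {ω : Ω} (hω : ω ∈ s) :
    shifted V s x ω = ENNReal.ofReal (V x ω - V 0 ω) := by
  simp [shifted, hω, hx]

/-- Uses `V⁺(x) ≤ (V(x) - V(0)) + V⁺(0)`; the price of the shift is an additive term in `V⁺(0)`,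
`V⁻(0)` and `C`. -/
theorem shifted_growth {V : ℝ → Ω → ℝ} {s : Set Ω} {ω : Ω} (hω : ω ∈ s)
    (hs : MonotoneOn (fun x => V x ω) (Set.Ici 0)) {C l γ : ℝ} (hl : 1 ≤ l)
    {x : ℝ} (hx : 0 ≤ x)
    (h : max (V (l * x) ω) 0 ≤ l ^ γ * max (V x ω) 0 + l ^ γ * C) :
    shifted V s (l * x) ω ≤ ENNReal.ofReal (l ^ γ) * shifted V s x ω +
      (ENNReal.ofReal (l ^ γ) * (ENNReal.ofReal (V 0 ω) + ENNReal.ofReal C)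
        + ENNReal.ofReal (-V 0 ω)) := by
  have hlγ : 0 ≤ l ^ γ := Real.rpow_nonneg (by linarith) _
  have hx0 : V 0 ω ≤ V x ω := hs (Set.mem_Ici.2 le_rfl) (Set.mem_Ici.2 hx) hx
  rw [shifted_of_nonneg (mul_nonneg (by linarith) hx) hω, shifted_of_nonneg hx hω, ← add_assoc,
    ← mul_add]
  have h1 : V (l * x) ω - V 0 ω ≤
      l ^ γ * ((V x ω - V 0 ω) + (max (V 0 ω) 0 + max C 0)) + max (-V 0 ω) 0 := by
    have h2 : max (V x ω) 0 ≤ (V x ω - V 0 ω) + max (V 0 ω) 0 :=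
      max_le (by linarith [le_max_left (V 0 ω) 0])
        (by linarith [le_max_right (V 0 ω) 0])
    have h3 : max (V x ω) 0 + C ≤ (V x ω - V 0 ω) + (max (V 0 ω) 0 + max C 0) := by
      linarith [le_max_left C 0]
    have h4 := mul_le_mul_of_nonneg_left h3 hlγ
    linarith [le_max_left (V (l * x) ω) 0, le_max_left (-V 0 ω) 0]
  refine (ENNReal.ofReal_le_ofReal h1).trans (ENNReal.ofReal_add_le.trans ?_)
  have h5 : ∀ y : ℝ, ENNReal.ofReal (max y 0) = ENNReal.ofReal y := fun y => by
    rcases le_total 0 y with hy | hy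
    · rw [max_eq_left hy]
    · rw [max_eq_right hy, ENNReal.ofReal_of_nonpos hy, ENNReal.ofReal_zero]
  rw [ENNReal.ofReal_mul hlγ, h5]
  gcongr
  refine ENNReal.ofReal_add_le.trans ?_
  gcongr
  refine ENNReal.ofReal_add_le.trans ?_
  rw [h5, h5]

variable {𝒢 mΩ : MeasurableSpace Ω} {P : Measure Ω}

theorem extCondExp_eq_of_add_eq {X : Ω → ℝ} {ω : Ω} {u p n : ℝ≥0∞} (hu : u < ∞) (hp : p < ∞)
    (hn : n < ∞) (hneg : condLExp 𝒢 P (fun ω => ENNReal.ofReal (-X ω)) ω ≤ n)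
    (h : condLExp 𝒢 P (fun ω => ENNReal.ofReal (X ω)) ω + n =
      (u + p) + condLExp 𝒢 P (fun ω => ENNReal.ofReal (-X ω)) ω) :
    extCondExp 𝒢 P X ω = ((u.toReal + (p.toReal - n.toReal) : ℝ) : EReal) := by
  rw [extCondExp]
  set a := condLExp 𝒢 P (fun ω => ENNReal.ofReal (X ω)) ω
  set b := condLExp 𝒢 P (fun ω => ENNReal.ofReal (-X ω)) ω
  have hb : b < ∞ := hneg.trans_lt hn
  have ha : a < ∞ := lt_of_le_of_lt (le_self_add.trans_eq h)
    (ENNReal.add_lt_top.2 ⟨ENNReal.add_lt_top.2 ⟨hu, hp⟩, hb⟩)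
  have h1 := congrArg ENNReal.toReal h
  rw [ENNReal.toReal_add ha.ne hn.ne, ENNReal.toReal_add (ENNReal.add_lt_top.2 ⟨hu, hp⟩).ne hb.ne,
    ENNReal.toReal_add hu.ne hp.ne] at h1
  rw [← EReal.coe_ennreal_toReal ha.ne, ← EReal.coe_ennreal_toReal hb.ne, ← EReal.coe_sub]
  congr 1
  linarith

theorem isEssSup_of_mem {α : Type*} [Preorder α] [MeasurableSpace α] {Φ : Set (Ω → α)}
    {f g : Ω → α} (hg : Measurable g) (hf : f ∈ Φ) (hfg : g =ᵐ[P] f)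
    (h : ∀ f' ∈ Φ, ∀ᵐ ω ∂P, f' ω ≤ f ω) : IsEssSup P Φ g := by
  refine ⟨hg, fun f' hf' => ?_, fun h' _ hh' => ?_⟩
  · filter_upwards [h f' hf', hfg] with ω h1 h2
    exact h1.trans h2.ge
  · filter_upwards [hh' f hf, hfg] with ω h1 h2
    exact h2.le.trans h1

end Utility

end OneStep

/-! ### Assembly of the main theorem. -/

theorem proposition4p5 {Ω : Type*} (𝒢 : MeasurableSpace Ω) [mΩ : MeasurableSpace Ω]
    (P : Measure Ω) [IsProbabilityMeasure P] [P.IsComplete]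
    (h𝒢 : 𝒢 ≤ mΩ) (h𝒢null : ∀ s : Set Ω, P s = 0 → MeasurableSet[𝒢] s)
    (d : ℕ) (hd : 0 < d)
    (Y : Ω → EuclideanSpace ℝ (Fin d)) (hY : Measurable Y)
    -- almost surely, the affine hull of the support of the conditional law is a linear subspace
    (hD : ∀ᵐ ω ∂P, ∃ W : Submodule ℝ (EuclideanSpace ℝ (Fin d)),
      (OneStep.condAffineHull 𝒢 P Y ω : Set (EuclideanSpace ℝ (Fin d))) = W)
    -- one-step quantitative absence of arbitrage
    (hNA : ∃ β κ : Ω → ℝ, Measurable[𝒢] β ∧ Measurable[𝒢] κ ∧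
      (∀ᵐ ω ∂P, 0 < β ω) ∧ (∀ᵐ ω ∂P, 0 < κ ω) ∧
      ∀ ξ ∈ OneStep.hullValued 𝒢 P Y, ∀ᵐ ω ∂P,
        κ ω ≤ (P⟦{ω' | inner ℝ (ξ ω') (Y ω') ≤ -β ω' * ‖ξ ω'‖}|𝒢⟧) ω)
    -- `V` is used on `[0, ∞) × Ω` only
    (V : ℝ → Ω → ℝ) (hVmeas : ∀ x : ℝ, 0 ≤ x → Measurable (V x))
    (hVreg : ∀ᵐ ω ∂P, ContinuousOn (fun x => V x ω) (Set.Ici 0) ∧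
      MonotoneOn (fun x => V x ω) (Set.Ici 0))
    -- integrability of the positive and of the negative part
    (hVpos : ∀ x : ℝ, 0 ≤ x → ∃ g : Ω → ℝ≥0∞,
      OneStep.IsEssSup P (OneStep.posValueFamily 𝒢 P Y V (fun _ => x)) g ∧ ∀ᵐ ω ∂P, g ω < ∞)
    (hVneg : ∀ᵐ ω ∂P, condLExp 𝒢 P (fun ω' => ENNReal.ofReal (-V 0 ω')) ω < ∞)
    -- growth condition
    (hVgrowth : ∃ γ : ℝ, 0 < γ ∧ ∃ C : Ω → ℝ, (∀ᵐ ω ∂P, 0 ≤ C ω) ∧ Integrable C P ∧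
      ∀ᵐ ω ∂P, ∀ l : ℝ, 1 ≤ l → ∀ x : ℝ, 0 ≤ x →
        max (V (l * x) ω) 0 ≤ l ^ γ * max (V x ω) 0 + l ^ γ * C ω) :
    ∃ G : ℝ → Ω → ℝ,
      -- joint measurability with respect to `ℬ([0, ∞)) ⊗ 𝒢`
      Measurable[MeasurableSpace.prod (inferInstance : MeasurableSpace (Set.Ici (0 : ℝ))) 𝒢]
        (fun p : Set.Ici (0 : ℝ) × Ω => G p.1 p.2) ∧
      -- `G x` is a version of the essential supremum at each constant `x ≥ 0`
      (∀ x : ℝ, 0 ≤ x →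
        OneStep.IsEssSup P (OneStep.valueFamily 𝒢 P Y V (fun _ => x))
          (fun ω => (G x ω : EReal))) ∧
      -- regularity of the paths
      (∀ᵐ ω ∂P, MonotoneOn (fun x => G x ω) (Set.Ici 0) ∧
        ContinuousOn (fun x => G x ω) (Set.Ici 0)) ∧
      ∀ H : Ω → ℝ, Measurable[𝒢] H → (∀ᵐ ω ∂P, 0 ≤ H ω) →
        -- `G(H(·), ·)` is the essential supremum at the random initial wealth `H`
        OneStep.IsEssSup P (OneStep.valueFamily 𝒢 P Y V H) (fun ω => (G (H ω) ω : EReal)) ∧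
        -- and it is attained
        ∃ ξ ∈ OneStep.admissible 𝒢 P Y H ∩ OneStep.hullValued 𝒢 P Y,
          ∀ᵐ ω ∂P, (G (H ω) ω : EReal) =
            OneStep.extCondExp 𝒢 P (fun ω' => V (H ω' + inner ℝ (ξ ω') (Y ω')) ω') ω := by
  obtain ⟨β, κ, hβm, -, hβ, hκ, hNA⟩ := hNA
  obtain ⟨γ, -, C, -, hCint, hVgrowth⟩ := hVgrowth
  let s : Set Ω := {ω | ContinuousOn (fun x => V x ω) (Set.Ici 0) ∧
    MonotoneOn (fun x => V x ω) (Set.Ici 0)}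
  -- The complement of `s` is null, hence in `𝒢`; this lets `U` be regular for every `ω`.
  have hs : MeasurableSet s := by
    have := h𝒢 _ (h𝒢null sᶜ hVreg)
    simpa using this.compl
  let U := OneStep.shifted V s
  let p : Ω → ℝ≥0∞ := condLExp 𝒢 P fun ω => ENNReal.ofReal (V 0 ω)
  let n : Ω → ℝ≥0∞ := condLExp 𝒢 P fun ω => ENNReal.ofReal (-V 0 ω)
  have hV0 : Measurable fun ω => ENNReal.ofReal (V 0 ω) := (hVmeas 0 le_rfl).ennreal_ofReal
  have hV0' : Measurable fun ω => ENNReal.ofReal (-V 0 ω) := (hVmeas 0 le_rfl).neg.ennreal_ofReal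
  have hposfin : ∀ x : ℝ, 0 ≤ x → ∀ ξ ∈ OneStep.admissible 𝒢 P Y fun _ => x, ∀ᵐ ω ∂P,
      condLExp 𝒢 P (fun ω => ENNReal.ofReal (V (x + inner ℝ (ξ ω) (Y ω)) ω)) ω < ∞ := by
    intro x hx ξ hξ
    obtain ⟨g, hg, hgt⟩ := hVpos x hx
    filter_upwards [hg.2.1 _ ⟨ξ, hξ, rfl⟩, hgt] with ω h1 h2
    exact h1.trans_lt h2
  have hp : ∀ᵐ ω ∂P, p ω < ∞ := by
    simpa using hposfin 0 le_rfl (fun _ => 0)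
      (OneStep.zero_mem_admissible (Filter.Eventually.of_forall fun _ => le_rfl))
  have hM : OneStep.IsModel 𝒢 P Y U := by
    refine ⟨h𝒢, hY, hD, ⟨β, hβm, hβ, fun H hH ξ hξ =>
      OneStep.norm_mul_le_of_noArbitrage h𝒢 hY hβm hκ hH hξ.1 (hNA ξ hξ.2)⟩,
      OneStep.measurable_shifted hVmeas hs, OneStep.continuous_shifted fun ω hω => hω.1,
      OneStep.monotone_shifted fun ω hω => hω.2, fun k hk => ?_, fun ξ hξ => ?_⟩
    · let C' := hCint.aestronglyMeasurable.mk C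
      have hC'm : Measurable C' := hCint.aestronglyMeasurable.stronglyMeasurable_mk.measurable
      have hCC' : C =ᵐ[P] C' := hCint.aestronglyMeasurable.ae_eq_mk
      have hC'fin : ∀ᵐ ω ∂P, condLExp 𝒢 P (fun ω => ENNReal.ofReal (C' ω)) ω < ∞ :=
        condLExp_lt_top (hCint.congr hCC').lintegral_lt_top.ne
      let c := ENNReal.ofReal ((k : ℝ) ^ γ)
      let F : Ω → ℝ≥0∞ := (fun ω => ENNReal.ofReal (V 0 ω)) + fun ω => ENNReal.ofReal (C' ω)
      have hF : Measurable F := hV0.add hC'm.ennreal_ofReal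
      refine ⟨c, c • F + fun ω => ENNReal.ofReal (-V 0 ω), ENNReal.ofReal_lt_top,
        (hF.const_smul c).add hV0', ?_, ?_⟩
      · filter_upwards [hp, hVneg, hC'fin,
          condLExp_add_right (mΩ := 𝒢) (P := P) (c • F) hV0'.aemeasurable,
          condLExp_smul (mΩ := 𝒢) (P := P) F hF.aemeasurable c,
          condLExp_add_left (mΩ := 𝒢) (P := P) (fun ω => ENNReal.ofReal (C' ω))
            hV0.aemeasurable] with ω h1 h2 h3 h4 h5 h6
        rw [h4, Pi.add_apply, h5, Pi.smul_apply, h6]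
        exact ENNReal.add_lt_top.2 ⟨ENNReal.mul_lt_top ENNReal.ofReal_lt_top
          (ENNReal.add_lt_top.2 ⟨h1, h3⟩), h2⟩
      · filter_upwards [hVreg, hVgrowth, hCC'] with ω h1 h2 h3 x hx
        have hk1 : (1 : ℝ) ≤ k := by exact_mod_cast hk
        have h4 := h2 k hk1 x hx
        rw [h3] at h4
        exact OneStep.shifted_growth (show ω ∈ s from h1) h1.2 hk1 hx h4
    · have hle : (fun ω => U (1 + inner ℝ (ξ ω) (Y ω)) ω) ≤ᵐ[P]
          (fun ω => ENNReal.ofReal (V (1 + inner ℝ (ξ ω) (Y ω)) ω)) +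
            fun ω => ENNReal.ofReal (-V 0 ω) := by
        filter_upwards [hVreg, hξ.2] with ω h1 h2
        simp only [U, OneStep.shifted_of_nonneg h2 (show ω ∈ s from h1), Pi.add_apply,
          sub_eq_add_neg]
        exact ENNReal.ofReal_add_le
      filter_upwards [condLExp_mono (mΩ := 𝒢) hle, hposfin 1 zero_le_one ξ hξ, hVneg,
        condLExp_add_right (mΩ := 𝒢) (P := P)
          (fun ω => ENNReal.ofReal (V (1 + inner ℝ (ξ ω) (Y ω)) ω)) hV0'.aemeasurable]
        with ω h1 h2 h3 h4
      refine h1.trans_lt ?_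
      rw [h4]
      exact ENNReal.add_lt_top.2 ⟨h2, h3⟩
  -- The generalized conditional expectation of `V 0`, finite almost surely; adding it back turns
  -- gains into the original values.
  let e : Ω → ℝ := fun ω => (p ω).toReal - (n ω).toReal
  have he : Measurable[𝒢] e := (measurable_condLExp _ _ _).ennreal_toReal.sub
    (measurable_condLExp _ _ _).ennreal_toReal
  have hext : ∀ H : Ω → ℝ, Measurable[𝒢] H → ∀ ξ ∈ OneStep.admissible 𝒢 P Y H, ∀ᵐ ω ∂P,
      OneStep.gain 𝒢 P Y U H ξ ω < ∞ ∧
      OneStep.extCondExp 𝒢 P (fun ω' => V (H ω' + inner ℝ (ξ ω') (Y ω')) ω') ω =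
        (((OneStep.gain 𝒢 P Y U H ξ ω).toReal + e ω : ℝ) : EReal) := by
    intro H hH ξ hξ
    let X : Ω → ℝ := fun ω' => V (H ω' + inner ℝ (ξ ω') (Y ω')) ω'
    let Z : Ω → ℝ≥0∞ := fun ω => U (H ω + inner ℝ (ξ ω) (Y ω)) ω
    have hZ : Measurable Z := hM.measurable_comp (hM.measurable_wealth hH hξ.1)
    have hV0X : ∀ᵐ ω ∂P, V 0 ω ≤ X ω := by
      filter_upwards [hVreg, hξ.2] with ω h1 h2
      exact h1.2 (Set.mem_Ici.2 le_rfl) (Set.mem_Ici.2 h2) h2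
    have hsum : (fun ω => ENNReal.ofReal (X ω)) + (fun ω => ENNReal.ofReal (-V 0 ω)) =ᵐ[P]
        (Z + fun ω => ENNReal.ofReal (V 0 ω)) + fun ω => ENNReal.ofReal (-X ω) := by
      filter_upwards [hVreg, hξ.2, hV0X] with ω h1 h2 h3
      simp only [Pi.add_apply, Z, U, OneStep.shifted_of_nonneg h2 (show ω ∈ s from h1)]
      exact OneStep.ofReal_add_ofReal_neg h3
    have hneg : (fun ω => ENNReal.ofReal (-X ω)) ≤ᵐ[P] fun ω => ENNReal.ofReal (-V 0 ω) := by
      filter_upwards [hV0X] with ω h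
      exact ENNReal.ofReal_le_ofReal (neg_le_neg h)
    filter_upwards [hp, hVneg, hM.gain_lt_top hH hξ, condLExp_congr_ae (mΩ := 𝒢) hsum,
      condLExp_mono (mΩ := 𝒢) hneg,
      condLExp_add_right (mΩ := 𝒢) (P := P) (fun ω => ENNReal.ofReal (X ω)) hV0'.aemeasurable,
      condLExp_add_left (mΩ := 𝒢) (P := P) (fun ω => ENNReal.ofReal (-X ω))
        (hZ.add hV0).aemeasurable,
      condLExp_add_right (mΩ := 𝒢) (P := P) Z hV0.aemeasurable] with ω h1 h2 h3 h4 h5 h6 h7 h8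
    refine ⟨h3, OneStep.extCondExp_eq_of_add_eq h3 h1 h2 h5 ?_⟩
    rw [h6, h7, Pi.add_apply, Pi.add_apply, h8] at h4
    exact h4
  obtain ⟨g, hgm, hgreg, hgH⟩ := hM.exists_value
  let G : ℝ → Ω → ℝ := fun x ω => (g x ω).toReal + e ω
  have hGm : Measurable[MeasurableSpace.prod inferInstance 𝒢] fun p : ℝ × Ω => G p.1 p.2 :=
    hgm.ennreal_toReal.add (he.comp measurable_snd)
  have hmain : ∀ H : Ω → ℝ, Measurable[𝒢] H → (∀ᵐ ω ∂P, 0 ≤ H ω) →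
      OneStep.IsEssSup P (OneStep.valueFamily 𝒢 P Y V H) (fun ω => (G (H ω) ω : EReal)) ∧
      ∃ ξ ∈ OneStep.admissible 𝒢 P Y H ∩ OneStep.hullValued 𝒢 P Y,
        ∀ᵐ ω ∂P, (G (H ω) ω : EReal) =
          OneStep.extCondExp 𝒢 P (fun ω' => V (H ω' + inner ℝ (ξ ω') (Y ω')) ω') ω := by
    intro H hH h0
    obtain ⟨ζ, hζ, hgζ, hmax⟩ := hgH H hH h0
    have hGζ : ∀ᵐ ω ∂P, (G (H ω) ω : EReal) =
        OneStep.extCondExp 𝒢 P (fun ω' => V (H ω' + inner ℝ (ζ ω') (Y ω')) ω') ω := by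
      filter_upwards [hext H hH ζ hζ.1, hgζ] with ω h1 h2
      rw [h1.2, ← h2]
    refine ⟨OneStep.isEssSup_of_mem ?_ ⟨ζ, hζ.1, rfl⟩ hGζ ?_, ζ, hζ, hGζ⟩
    · exact measurable_coe_real_ereal.comp
        ((hGm.comp (hH.prodMk measurable_id)).mono h𝒢 le_rfl)
    · rintro _ ⟨ξ, hξ, rfl⟩
      filter_upwards [hext H hH ζ hζ.1, hext H hH ξ hξ, hmax ξ hξ] with ω h1 h2 h3
      refine h2.2.le.trans (le_trans ?_ h1.2.ge)
      rw [EReal.coe_le_coe_iff]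
      exact add_le_add_left (ENNReal.toReal_mono h1.1.ne h3) _
  refine ⟨G, ?_, fun x hx => (hmain (fun _ => x) measurable_const
    (Filter.Eventually.of_forall fun _ => hx)).1, ?_, hmain⟩
  · exact hGm.comp ((measurable_subtype_coe.comp measurable_fst).prodMk measurable_snd)
  · filter_upwards [hgreg] with ω ⟨h1, h2, h3⟩
    refine ⟨fun x _ y _ hxy => ?_, ?_⟩
    · exact add_le_add_left (ENNReal.toReal_mono (h1 y).ne (h2 hxy)) _
    · exact (ENNReal.continuousOn_toReal.comp h3 fun x _ => (h1 x).ne).add continuousOn_const
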